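/- **Conventions.** For $s\in\mathbb R$ and $x\in\mathbb R^2$ put $Q'_s(x)=x+[-\tfrac s2,\tfrac s2]^2$ (empty if $s<0$), $Q_s(x)=Q'_s(x)\times[0,1]$, $Q(x)=Q_1(x)$, $Q'_n=Q'_n(o)$, $Q_n=Q_n(o)$ and $Q_\infty=\mathbb R^2\times[0,1]$. **Model.** Let $\mathcal P=\{P_i\}_{i}$ be a homogeneous Poisson point process of intensity $\lambda>0$ on $Q_\infty$ and $0<\eta_0<1/4$. To each $P_i$ attach a noise path $N_i\colon[0,1]\to B(o,\eta_0)\subset\mathbb R^2$; the paths are independent for different $i$ and independent of $(P_i)_i$, each $N_i(h)$ is uniform on the ball $B(o,\eta_0)$, and the dependence between different $h$ is arbitrary. For a window $W\subseteq\mathbb R^3$, a configuration $\varphi$ of points of $\mathbb R^3$ carrying noise paths, and a point $P$ with noise path $N$, let $$C_W(P,\varphi)=\{y\in W:\ |y-P|\le|y-P'|\text{ for all }P'\in\varphi\}$$ be the Voronoi cell of $P$ in $W$. If it is bounded, then for each $h\in[0,1]$ for which the section $C_W(P,\varphi)\cap(\mathbb R^2\times\{h\})$ has positive area let $G(h)\in\mathbb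 R^2$ be the centroid of this section, and let $\mathcal T_W(P,\varphi)$ be the trajectory $\{(G(h)+N(h),h)\}_h$ over these $h$; if the cell is unbounded, $\mathcal T_W(P,\varphi)=\varnothing$. Write $\mathcal T_n=\mathcal T_{Q_n}$ for $1\le n\le\infty$. With $\mathcal P_n=\mathcal P\cap Q_n$, consider the trajectories $$\mathcal X_n=\{\mathcal T_n(P_i,\mathcal P_n)\}_{P_i\in\mathcal P\cap Q_{n-\sqrt n}},\qquad n\ge1 .$$ **Stabilization.** Fix $M>0$. Write $\varphi_{r,\mathcal A}=\mathcal A\cup(\varphi\cap Q_r(x))$ and $\varphi_{r,\mathcal A,\mathcal B}=\mathcal A\cup\mathcal B\cup(\varphi\cap(Q_r(x)\setminus Q(x)))$, and let $\mathsf{dist}(f,g)$ be the infimum of $|f(h)-g(h)|$ over all $h$ at which both trajectories are present ($\infty$ if there are none). For $1\le n\le\infty$, a configuration $\varphi\subseteq Q_n$ *stabilizes for $x\in\mathbb R^2$ at $r\ge1$ relative to $Q_n$* if - (S1) $\mathcal T_n(P,\varphi_{r,\mathcal A,\mathcal B})=\mathcal T_n(P,\varphi_{r,\mathcal A,\varnothing})$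 for all finite $\mathcal A\subseteq Q_n\setminus Q_r(x)$, $\mathcal B\subseteq Q(x)$ and $P\in\varphi_{r,\mathcal A}\setminus Q_r(x)$; - (S2) $\mathsf{dist}\big(\mathcal T_n(P,\varphi_{2r,\mathcal A,\mathcal B}),\mathcal T_n(P',\varphi_{2r,\mathcal A,\mathcal B})\big)>M$ for all finite $\mathcal A\subseteq Q_n\setminus Q_{2r}(x)$, $\mathcal B\subseteq Q(x)$, $P\in\mathcal A$ and $P'\in\varphi_{2r,\mathcal A,\mathcal B}\cap Q_r(x)$; - (S3) $\mathcal T_n(P,\varphi_{4r,\mathcal A})=\mathcal T_n(P,\varphi_{4r,\varnothing})$ for all finite $\mathcal A\subseteq Q_n\setminus Q_{4r}(x)$ and $P\in\varphi\cap Q_{2r}(x)$; - (S3') if $n=\infty$, in addition $\mathcal T_\infty(P,\varphi_{4r,\mathcal A})\subseteq Q_{4r}(x)$ for all finite $\mathcal A\subseteq\mathbb R^3\setminus Q_{4r}(x)$ and $P\in\varphi\cap Q_{2r}(x)$. The points of $\mathcal A$ and $\mathcal B$ carry arbitrary noise paths with values in $B(o,\eta_0)$. Let $R'(x,n)$ be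 the smallest integer $r\ge1$ at which $\mathcal P\cap Q_n$ stabilizes for $x$ relative to $Q_n$ ($\infty$ if there is none), and $R(x,n)=R'(x,n)\vee R'(x,\infty)$. **Statement.** For all $\lambda>0$, $0<\eta_0<1/4$, $M>0$ and all noise paths as above: 1. $\mathcal T$ is measurable (in every window $Q_n$, $1\le n\le\infty$, the position at height $h$ of the trajectory of a point of a finite configuration, possibly absent, is a measurable function of the points of the configuration and their noise paths) and covariant under horizontal translations $v$, i.e. $\mathcal T_{W+v}(P+v,\varphi+v)=\mathcal T_W(P,\varphi)+v$. 2. $\mathcal T$ is exponentially stabilizing: for some $c>0$, $$\limsup_{r\to\infty}\ \sup_{n\ge1,\ x\in Q'_n}\frac{\log\mathbb P(R(x,n)>r)}{r^c}<0 .$$ 3. The factorial-moment-density bound (M) holds, uniformly in slice and window: for every $q\ge0$ there is $C_q>0$ such that for all $n\ge1$ and $h\in[0,1]$ there is a measurable $\rho_{h,q,n}\colon(\mathbb R^2)^{q+1}\to[0,C_q]$ with $$\mathbb E\Big[\sum f\big(X_{i_0,n}(h),\dots,X_{i_q,n}(h)\big)\Big]=\int_{(\mathbb R^2)^{q+1}}f\,\rho_{h,q,n}\,\mathrm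 d(x_0,\dots,x_q)$$ for all measurable $f\ge0$, where the sum is over pairwise distinct trajectories $X_{i_0,n},\dots,X_{i_q,n}$ of $\mathcal X_n$ present at height $h$. The same holds if $\mathcal X_n$ is replaced by the family $\{\mathcal T_n(P_i,\mathcal P_n)\}_{P_i\in\mathcal P_n}$ of all trajectories in $Q_n$. That is, this model satisfies the conditions that the scalar central limit theorem (a measurable, translation-covariant, exponentially stabilizing construction rule) and the functional central limit theorem (in addition the bound (M)) impose on the trajectory model. -/

import Mathlib

open MeasureTheory ProbabilityTheory Filter Topology
open scoped ENNReal NNReal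

noncomputable section

namespace SlicedVoronoi

/-! ### Geometry of the slab and of its slices -/

/-- The plane `ℝ²` in which the slices live. -/
abbrev Plane : Type := EuclideanSpace ℝ (Fin 2)

/-- The ambient space `ℝ³`; the last coordinate is the height along which slices are taken. -/
abbrev Space : Type := EuclideanSpace ℝ (Fin 3)

/-- The point `(u, h)` of `ℝ² × ℝ = ℝ³`. -/
def lift (u : Plane) (h : ℝ) : Space := !₂[u 0, u 1, h]

/-- The square `Q'_s(x) = x + [-s/2, s/2]²`. -/
def square (s : ℝ) (x : Plane) : Set Plane := {u | ∀ i, |u i - x i| ≤ s / 2}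

/-- The box `Q_s(x) = (x + [-s/2, s/2]²) × [0, 1]`. -/
def box (s : ℝ) (x : Plane) : Set Space := {y | ∃ u ∈ square s x, ∃ h ∈ Set.Icc (0 : ℝ) 1, y = lift u h}

/-- The slab `ℝ² × [0, 1]`. -/
def slab : Set Space := {y | ∃ u : Plane, ∃ h ∈ Set.Icc (0 : ℝ) 1, y = lift u h}

/-- The sampling windows: `Q_n = [-n/2, n/2]² × [0, 1]` for finite `n`, and `Q_∞ = ℝ² × [0, 1]`. -/
def window : ℕ∞ → Set Space
  | ⊤ => slab
  | (n : ℕ) => box n 0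

/-- The slice at height `h` of a subset of `ℝ³`, seen in the plane. -/
def slice (f : Set Space) (h : ℝ) : Set Plane := {u | lift u h ∈ f}

/-- The distance of two trajectories (given through their graphs): the infimum, over the heights at
which both are present, of the distance of their positions. It is `∞` if there are none. -/
def trajDist (f g : Set Space) : ℝ≥0∞ :=
  ⨅ (h : ℝ) (u ∈ slice f h) (v ∈ slice g h), edist u v

/-! ### Marked configurations and construction rules -/

/-- Noise paths `[0, 1] → B(o, η)`, without any regularity in the height. -/
abbrev NoisePath (η : ℝ) : Type := unitInterval → Metric.closedBall (0 : Plane) η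

/-- A point of `ℝ³` together with the noise path attached to it. -/
abbrev MarkedPoint (η : ℝ) : Type := Space × NoisePath η

/-- The marked points of `φ` whose location lies in `S`. -/
def within {η : ℝ} (φ : Set (MarkedPoint η)) (S : Set Space) : Set (MarkedPoint η) :=
  {P ∈ φ | P.1 ∈ S}

/-- A construction rule `𝒯`: for a window `W`, a marked point `P` and a marked configuration `φ`,
`𝒯 W P φ ⊆ ℝ³` is the graph of the trajectory that `P` generates in the configuration `φ`. -/
abbrev Rule (η : ℝ) : Type :=
  Set Space → MarkedPoint η → Set (MarkedPoint η) → Set Space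

/-- Covariance under horizontal translations (for finite windows, the window is moved as well). -/
def TranslationCovariant {η : ℝ} (T : Rule η) : Prop :=
  ∀ (v : Plane) (W : Set Space) (P : MarkedPoint η) (φ : Set (MarkedPoint η)),
    T ((fun y => y + lift v 0) '' W) (P.1 + lift v 0, P.2)
        ((fun P' : MarkedPoint η => (P'.1 + lift v 0, P'.2)) '' φ) =
      (fun y => y + lift v 0) '' T W P φ

/-- Measurability of a construction rule: for each window `Q_n`, `n ≤ ∞`, the position at height `h`
of the trajectory of a point in a finite configuration (possibly absent) depends measurably on the
points of the configuration. -/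
def MeasurableRule {η : ℝ} (T : Rule η) : Prop :=
  ∀ (n : ℕ∞) (k : ℕ) (h : ℝ) (A : Set Plane), MeasurableSet A →
    MeasurableSet {p : Fin (k + 1) → MarkedPoint η |
      ∃ u ∈ A, u ∈ slice (T (window n) (p 0) (Set.range p)) h}

/-! ### Stabilization -/

/-- `φ_{r,𝒜} = 𝒜 ∪ (φ ∩ Q_r(x))`. -/
def modify {η : ℝ} (φ : Set (MarkedPoint η)) (x : Plane) (r : ℝ) (A : Set (MarkedPoint η)) :
    Set (MarkedPoint η) :=
  A ∪ within φ (box r x)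

/-- `φ_{r,𝒜,ℬ} = 𝒜 ∪ ℬ ∪ (φ ∩ (Q_r(x) ∖ Q_1(x)))`. -/
def modify₂ {η : ℝ} (φ : Set (MarkedPoint η)) (x : Plane) (r : ℝ) (A B : Set (MarkedPoint η)) :
    Set (MarkedPoint η) :=
  A ∪ B ∪ within φ (box r x \ box 1 x)

/-- The finite marked configurations with locations in `S`. -/
def FiniteIn {η : ℝ} (S : Set Space) (A : Set (MarkedPoint η)) : Prop :=
  A.Finite ∧ ∀ P ∈ A, P.1 ∈ S

/-- First stabilization condition, for `φ` at `x`, with radius `r`, relative to the window `W`: what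
happens inside `Q_1(x)` is irrelevant for the trajectories of points outside `Q_r(x)`. -/
def S1 {η : ℝ} (T : Rule η) (W : Set Space) (φ : Set (MarkedPoint η)) (x : Plane) (r : ℝ) : Prop :=
  ∀ A B : Set (MarkedPoint η), FiniteIn (W \ box r x) A → FiniteIn (box 1 x) B →
    ∀ P ∈ modify φ x r A, P.1 ∉ box r x →
      T W P (modify₂ φ x r A B) = T W P (modify₂ φ x r A ∅)

/-- Second stabilization condition: trajectories of points added outside `Q_{2r}(x)` stay at distance
more than `M` from those of points in `Q_r(x)`. -/
def S2 {η : ℝ} (T : Rule η) (M : ℝ) (W : Set Space) (φ : Set (MarkedPoint η)) (x : Plane) (r : ℝ) :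
    Prop :=
  ∀ A B : Set (MarkedPoint η), FiniteIn (W \ box (2 * r) x) A → FiniteIn (box 1 x) B →
    ∀ P ∈ A, ∀ P' ∈ within (modify₂ φ x (2 * r) A B) (box r x),
      ENNReal.ofReal M <
        trajDist (T W P (modify₂ φ x (2 * r) A B)) (T W P' (modify₂ φ x (2 * r) A B))

/-- Third stabilization condition: trajectories of points in `Q_{2r}(x)` do not depend on the
configuration outside `Q_{4r}(x)`. -/
def S3 {η : ℝ} (T : Rule η) (W : Set Space) (φ : Set (MarkedPoint η)) (x : Plane) (r : ℝ) : Prop :=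
  ∀ A : Set (MarkedPoint η), FiniteIn (W \ box (4 * r) x) A →
    ∀ P ∈ within φ (box (2 * r) x),
      T W P (modify φ x (4 * r) A) = T W P (modify φ x (4 * r) ∅)

/-- Additional condition for the infinite window `W = Q_∞`: trajectories of points in `Q_{2r}(x)` are
contained in `Q_{4r}(x)`. -/
def S3' {η : ℝ} (T : Rule η) (W : Set Space) (φ : Set (MarkedPoint η)) (x : Plane) (r : ℝ) : Prop :=
  ∀ A : Set (MarkedPoint η), FiniteIn (box (4 * r) x)ᶜ A →
    ∀ P ∈ within φ (box (2 * r) x), T W P (modify φ x (4 * r) A) ⊆ box (4 * r) x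

/-- `φ ⊆ Q_n` stabilizes for `x` at `r` relative to `Q_n`, where `n ≤ ∞`. -/
def Stabilizes {η : ℝ} (T : Rule η) (M : ℝ) (n : ℕ∞) (φ : Set (MarkedPoint η)) (x : Plane) (r : ℝ) :
    Prop :=
  S1 T (window n) φ x r ∧ S2 T M (window n) φ x r ∧ S3 T (window n) φ x r ∧
    (n = ⊤ → S3' T (window n) φ x r)

/-- `R'(x, n; φ)`: the smallest integer `r ≥ 1` at which `φ ∩ Q_n` stabilizes for `x` relative to
`Q_n`; it is `∞` if there is none. -/
def stabRadius' {η : ℝ} (T : Rule η) (M : ℝ) (x : Plane) (n : ℕ∞) (φ : Set (MarkedPoint η)) : ℕ∞ :=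
  ⨅ (r : ℕ) (_ : 1 ≤ r) (_ : Stabilizes T M n (within φ (window n)) x r), (r : ℕ∞)

/-- The stabilization radius `R(x, n; φ) = R'(x, n; φ) ∨ R'(x, ∞; φ)`. -/
def stabRadius {η : ℝ} (T : Rule η) (M : ℝ) (x : Plane) (n : ℕ) (φ : Set (MarkedPoint η)) : ℕ∞ :=
  stabRadius' T M x n φ ⊔ stabRadius' T M x ⊤ φ

/-- Exponential stabilization of the rule `T` for the random marked configuration `Φ`: for some
`c > 0`, `limsup_{r → ∞} sup_{n ≥ 1, x ∈ Q'_n} log ℙ(R(x, n; Φ) > r) / r ^ c < 0`. -/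
def ExponentiallyStabilizing {Ω : Type*} [MeasurableSpace Ω] (μ : Measure Ω) {η : ℝ} (T : Rule η)
    (M : ℝ) (Φ : Ω → Set (MarkedPoint η)) : Prop :=
  ∃ c : ℝ, 0 < c ∧
    limsup (fun r : ℕ => ⨆ (n : ℕ) (_ : 1 ≤ n) (x ∈ square n 0),
      ENNReal.log (μ {ω | (r : ℕ∞) < stabRadius T M x n (Φ ω)}) / (((r : ℝ) ^ c : ℝ) : EReal))
      atTop < 0

/-! ### Factorial moment densities -/

/-- The bound on factorial moment densities for a family of point processes of trajectories: `X n ω i` is the graph of the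
`i`-th trajectory for the window `Q_n` (empty if there is none). For every `q`, the points
`X_{i,n}(h)` have a factorial moment density `ρ_{h,q,n}` of order `q + 1`, bounded by a constant that
depends neither on the slice `h ∈ [0, 1]` nor on `n ≥ 1`. The sum runs over pairwise distinct indices
`i_0, …, i_q` of trajectories that are present at height `h`. -/
def FactorialMomentBound {Ω : Type*} [MeasurableSpace Ω] (μ : Measure Ω)
    (X : ℕ → Ω → ℕ → Set Space) : Prop :=
  ∀ q : ℕ, ∃ C : ℝ, 0 < C ∧ ∀ n : ℕ, 1 ≤ n → ∀ h ∈ Set.Icc (0 : ℝ) 1,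
    ∃ ρ : (Fin (q + 1) → Plane) → ℝ≥0∞, Measurable ρ ∧ (∀ x, ρ x ≤ ENNReal.ofReal C) ∧
      ∀ f : (Fin (q + 1) → Plane) → ℝ≥0∞, Measurable f →
        ∫⁻ ω, ∑' i : Fin (q + 1) ↪ ℕ,
            ∑' u : {u : Fin (q + 1) → Plane // ∀ j, u j ∈ slice (X n ω (i j)) h}, f u.1 ∂μ =
          ∫⁻ x, f x * ρ x

/-! ### The Poisson process and the noise -/

/-- The number of indices `i` with `P_i ∈ B`. -/
def count {Ω : Type*} (pt : ℕ → Ω → Space) (B : Set Space) (ω : Ω) : ℕ∞ :=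
  {i | pt i ω ∈ B}.encard

/-- `(P_i)` is a (measurable enumeration of a) homogeneous Poisson point process with intensity `lam`
on the slab `ℝ² × [0, 1]`: the number of points in a Borel set `B` is Poisson distributed with mean
`lam * |B ∩ slab|` whenever this is finite, and the numbers of points in disjoint Borel sets are
independent. -/
structure IsPoissonProcess {Ω : Type*} [MeasurableSpace Ω] (μ : Measure Ω) (lam : ℝ≥0)
    (pt : ℕ → Ω → Space) : Prop where
  measurable_pt : ∀ i, Measurable (pt i)
  law : ∀ B : Set Space, MeasurableSet B → volume (B ∩ slab) ≠ ∞ →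
    μ.map (count pt B) =
      (poissonMeasure (lam * (volume (B ∩ slab)).toNNReal)).map (fun k : ℕ => (k : ℕ∞))
  indep : ∀ (k : ℕ) (B : Fin k → Set Space), (∀ j, MeasurableSet (B j)) →
    Pairwise (fun i j => Disjoint (B i) (B j)) → iIndepFun (fun j => count pt (B j)) μ

/-- The noise paths `N_i` are independent for different `i`, independent of the points `(P_i)`, and
each `N_i(h)` is uniformly distributed in the ball `B(o, η)`. The dependence between different heights
`h` is arbitrary. -/
structure IsUniformNoise {Ω : Type*} [MeasurableSpace Ω] (μ : Measure Ω) {η : ℝ}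
    (pt : ℕ → Ω → Space) (noise : ℕ → Ω → NoisePath η) : Prop where
  measurable_noise : ∀ i, Measurable (noise i)
  iIndep : iIndepFun noise μ
  indep_pt : IndepFun (fun ω i => noise i ω) (fun ω i => pt i ω) μ
  uniform : ∀ (i : ℕ) (h : unitInterval),
    μ.map (fun ω => (noise i ω h : Plane)) = cond volume (Metric.closedBall (0 : Plane) η)

/-- The Poisson points, with their noise paths attached. -/
def config {Ω : Type*} {η : ℝ} (pt : ℕ → Ω → Space) (noise : ℕ → Ω → NoisePath η) (ω : Ω) :
    Set (MarkedPoint η) :=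
  Set.range fun i => (pt i ω, noise i ω)

/-! ### Perturbed centroids of the slices of Voronoi cells -/

/-- The cell of `P` in the Voronoi tessellation of the window `W` generated by the locations of
`φ`. -/
def cell {η : ℝ} (W : Set Space) (P : MarkedPoint η) (φ : Set (MarkedPoint η)) : Set Space :=
  {y ∈ W | ∀ P' ∈ φ, dist y P.1 ≤ dist y P'.1}

/-- The centroid of a planar set of positive finite area. -/
def centroid (K : Set Plane) : Plane := ⨍ u in K, u

/-- The construction rule of the model. If the cell of `P` is bounded, its trajectory consists of the
points `(G(h) + N(h), h)`, where `h ∈ [0, 1]` is a height at which the section of the cell has positive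
area, `G(h)` is the centroid of this section and `N` is the noise path of `P`. -/
def centroidRule (η : ℝ) : Rule η := fun W P φ =>
  {y | Bornology.IsBounded (cell W P φ) ∧ ∃ h : unitInterval, 0 < volume (slice (cell W P φ) h) ∧
    y = lift (centroid (slice (cell W P φ) h) + (P.2 h : Plane)) h}

/-- The trajectories `𝒯(P_i, 𝒫_n)`, `𝒫_n = 𝒫 ∩ Q_n`, of those Poisson points that lie in `Q_s`, where
`s = s(n)`. -/
def trajectories {Ω : Type*} {η : ℝ} (T : Rule η) (pt : ℕ → Ω → Space)
    (noise : ℕ → Ω → NoisePath η) (s : ℕ → ℝ) (n : ℕ) (ω : Ω) (i : ℕ) : Set Space :=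
  {y | pt i ω ∈ box (s n) 0 ∧
    y ∈ T (window n) (pt i ω, noise i ω) (within (config pt noise ω) (window n))}

end SlicedVoronoi

end

namespace SlicedVoronoi

/-! A Voronoi cell is an intersection of half-spaces with a convex window. It is therefore convex
and closed, and so are its sections: the centroid of a section lies in the section, and the
trajectory stays within `η` of the cell. All geometric claims about trajectories reduce to claims
about cells.

Stabilization. Suppose every location near `Q_{2r}(x)` has a Poisson point outside `Q_1(x)` within
distance `r / 16` (`IsDense`). Then a cell cannot extend far from its generator
(`hdist_le_of_mem_cell`), and a distant generator's cell cannot come close to `x`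
(`lt_hdist_of_mem_cell`). This separation of cells gives all the stabilization conditions at once
(`stabilizes_of_isDense`). Density follows as soon as none of boundedly many boxes of side `r / 64`
is void. The failure probability is therefore at most a constant times `exp (-λ (r / 64) ^ 2)`,
uniformly in `n` and `x`. If the window is small compared with `r`, nothing lies outside `Q_r(x)`
and stabilization is trivial (`stabilizes_of_window_subset`).

Moment densities. At a fixed height, presence and centroid depend on the points alone, while the
noise is independent and uniform. Given the points, each tuple of distinct trajectories thus has
density `|B(o, η)|⁻¹ ^ (q + 1)` times the indicator that the centroids are within `η` of the
arguments (`lintegral_perturbed_eq`). Summing over tuples, the density is bounded by moments of the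
number of centroids near a location `u` (`exists_density_of_perturbed`). Let `r` be the least size
at which a box in the window near `u` contains a point. Every generator whose centroid is near `u`
then lies in a column of half-width `4 r` (`mem_column_of_hit`). Void probabilities decay like `exp
(-λ r ^ 2)`, which beats the moments of the Poisson number of points in that column. -/

/-! ### Coordinates -/

/-- The horizontal distance, in the supremum norm, of a point of `ℝ³` from a point of the plane. -/
def hdist (x : Plane) (y : Space) : ℝ := max |y 0 - x 0| |y 1 - x 1|

@[simp] lemma lift_zero (u : Plane) (h : ℝ) : lift u h 0 = u 0 := by simp [lift]
@[simp] lemma lift_one (u : Plane) (h : ℝ) : lift u h 1 = u 1 := by simp [lift]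
@[simp] lemma lift_two (u : Plane) (h : ℝ) : lift u h 2 = h := by simp [lift]

lemma space_ext {y z : Space} (h0 : y 0 = z 0) (h1 : y 1 = z 1) (h2 : y 2 = z 2) : y = z := by
  ext i; fin_cases i <;> assumption

lemma plane_ext {y z : Plane} (h0 : y 0 = z 0) (h1 : y 1 = z 1) : y = z := by
  ext i; fin_cases i <;> assumption

lemma lift_inj {u v : Plane} {h k : ℝ} : lift u h = lift v k ↔ u = v ∧ h = k := by
  constructor
  · intro e
    have e0 := congrArg (fun y : Space => y 0) e
    have e1 := congrArg (fun y : Space => y 1) e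
    have e2 := congrArg (fun y : Space => y 2) e
    simp only [lift_zero, lift_one, lift_two] at e0 e1 e2
    exact ⟨plane_ext e0 e1, e2⟩
  · rintro ⟨rfl, rfl⟩; rfl

lemma exists_eq_lift (y : Space) : ∃ u : Plane, y = lift u (y 2) :=
  ⟨!₂[y 0, y 1], space_ext (by simp) (by simp) (by simp)⟩

lemma mem_slab {y : Space} : y ∈ slab ↔ y 2 ∈ Set.Icc (0 : ℝ) 1 := by
  constructor
  · rintro ⟨u, h, hh, rfl⟩; simpa using hh
  · intro h
    obtain ⟨u, hu⟩ := exists_eq_lift y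
    exact ⟨u, _, h, hu⟩

lemma mem_square {s : ℝ} {x u : Plane} :
    u ∈ square s x ↔ |u 0 - x 0| ≤ s / 2 ∧ |u 1 - x 1| ≤ s / 2 := by
  simp [square, Fin.forall_fin_two]

lemma hdist_le {x : Plane} {y : Space} {t : ℝ} :
    hdist x y ≤ t ↔ |y 0 - x 0| ≤ t ∧ |y 1 - x 1| ≤ t := max_le_iff

lemma mem_box {s : ℝ} {x : Plane} {y : Space} :
    y ∈ box s x ↔ hdist x y ≤ s / 2 ∧ y 2 ∈ Set.Icc (0 : ℝ) 1 := by
  rw [hdist_le]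
  constructor
  · rintro ⟨u, hu, h, hh, rfl⟩
    simpa using ⟨mem_square.1 hu, hh⟩
  · rintro ⟨h1, h2⟩
    obtain ⟨u, hu⟩ := exists_eq_lift y
    refine ⟨u, mem_square.2 ?_, _, h2, hu⟩
    rw [hu] at h1
    simpa using h1

lemma mem_box_of_mem_slab {s : ℝ} {x : Plane} {y : Space} (hy : y ∈ slab) :
    y ∈ box s x ↔ hdist x y ≤ s / 2 := by
  rw [mem_box, and_iff_left (mem_slab.1 hy)]

lemma box_subset_slab (s : ℝ) (x : Plane) : box s x ⊆ slab :=
  fun _ hy => mem_slab.2 (mem_box.1 hy).2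

lemma abs_sub_le_dist (y z : Space) (i : Fin 3) : |y i - z i| ≤ dist y z := by
  have := PiLp.norm_apply_le (y - z) i
  rw [dist_eq_norm]
  simpa using this

lemma hdist_le_add_dist (x : Plane) (y z : Space) : hdist x y ≤ hdist x z + dist y z := by
  have h0 := abs_sub_le_dist y z 0
  have h1 := abs_sub_le_dist y z 1
  have k0 : |z 0 - x 0| ≤ hdist x z := le_max_left _ _
  have k1 : |z 1 - x 1| ≤ hdist x z := le_max_right _ _
  rw [hdist_le]
  constructor
  · have := abs_sub_le (y 0) (z 0) (x 0); linarith
  · have := abs_sub_le (y 1) (z 1) (x 1); linarith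

lemma dist_le_sum (y z : Space) : dist y z ≤ |y 0 - z 0| + |y 1 - z 1| + |y 2 - z 2| := by
  rw [EuclideanSpace.dist_eq, Fin.sum_univ_three]
  apply Real.sqrt_le_iff.2
  simp only [Real.dist_eq]
  constructor
  · positivity
  · nlinarith [abs_nonneg (y 0 - z 0), abs_nonneg (y 1 - z 1), abs_nonneg (y 2 - z 2),
      mul_nonneg (abs_nonneg (y 0 - z 0)) (abs_nonneg (y 1 - z 1)),
      mul_nonneg (abs_nonneg (y 0 - z 0)) (abs_nonneg (y 2 - z 2)),
      mul_nonneg (abs_nonneg (y 1 - z 1)) (abs_nonneg (y 2 - z 2))]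

lemma dist_lift (u v : Plane) (h : ℝ) : dist (lift u h) (lift v h) = dist u v := by
  rw [EuclideanSpace.dist_eq, EuclideanSpace.dist_eq, Fin.sum_univ_three, Fin.sum_univ_two]
  simp

lemma continuous_lift : Continuous fun p : Plane × ℝ => lift p.1 p.2 := by
  unfold lift
  refine (PiLp.continuous_toLp 2 _).comp ?_
  refine continuous_pi fun i => ?_
  fin_cases i <;> simp <;> fun_prop

lemma continuous_hdist (x : Plane) : Continuous (hdist x) := by
  unfold hdist; fun_prop

/-! ### Convexity and closedness -/

lemma convex_hdist_le (x : Plane) (t : ℝ) : Convex ℝ {y : Space | hdist x y ≤ t} := by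
  intro y hy z hz a b ha hb hab
  simp only [Set.mem_ofPred_eq, hdist_le, abs_le] at hy hz ⊢
  simp only [PiLp.add_apply, PiLp.smul_apply, smul_eq_mul]
  have hb' : b = 1 - a := by linarith
  subst hb'
  refine ⟨⟨?_, ?_⟩, ?_, ?_⟩ <;> nlinarith

lemma convex_slab : Convex ℝ slab := by
  intro y hy z hz a b ha hb hab
  rw [mem_slab] at *
  exact convex_Icc (0 : ℝ) 1 hy hz ha hb hab

lemma convex_box (s : ℝ) (x : Plane) : Convex ℝ (box s x) := by
  have : box s x = {y | hdist x y ≤ s / 2} ∩ slab := by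
    ext y; rw [mem_box, Set.mem_inter_iff, mem_slab]; rfl
  rw [this]; exact (convex_hdist_le _ _).inter convex_slab

lemma isClosed_slab : IsClosed slab := by
  have : slab = (fun y : Space => y 2) ⁻¹' Set.Icc 0 1 := by ext y; exact mem_slab
  rw [this]; exact isClosed_Icc.preimage (by fun_prop)

lemma isClosed_box (s : ℝ) (x : Plane) : IsClosed (box s x) := by
  have : box s x = hdist x ⁻¹' Set.Iic (s / 2) ∩ slab := by
    ext y; rw [mem_box, Set.mem_inter_iff, mem_slab]; rfl
  rw [this]; exact (isClosed_Iic.preimage (continuous_hdist x)).inter isClosed_slab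

lemma isBounded_box (s : ℝ) (x : Plane) : Bornology.IsBounded (box s x) := by
  refine Metric.isBounded_iff_subset_closedBall (lift x 0) |>.2 ⟨s / 2 + s / 2 + 1, fun y hy => ?_⟩
  rw [mem_box, hdist_le] at hy
  refine (dist_le_sum _ _).trans ?_
  simp only [lift_zero, lift_one, lift_two, sub_zero]
  have := hy.2.2
  rw [abs_of_nonneg hy.2.1]
  linarith [hy.1.1, hy.1.2]

@[simp] lemma window_coe (n : ℕ) : window n = box n 0 := rfl

lemma window_subset_slab (n : ℕ∞) : window n ⊆ slab := by
  induction n with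
  | top => exact subset_rfl
  | coe n => exact box_subset_slab _ _

lemma convex_window (n : ℕ∞) : Convex ℝ (window n) := by
  induction n with
  | top => exact convex_slab
  | coe n => exact convex_box _ _

lemma isClosed_window (n : ℕ∞) : IsClosed (window n) := by
  induction n with
  | top => exact isClosed_slab
  | coe n => exact isClosed_box _ _

/-- Squaring cancels the term `‖y‖ ^ 2` and leaves a half-space. -/
lemma convex_dist_le_dist (a b : Space) : Convex ℝ {y : Space | dist y a ≤ dist y b} := by
  have : {y : Space | dist y a ≤ dist y b} =
      {y | innerSL ℝ (2 • (b - a)) y ≤ ‖b‖ ^ 2 - ‖a‖ ^ 2} := by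
    ext y
    simp only [Set.mem_ofPred_eq, dist_eq_norm, innerSL_apply_apply]
    rw [← sq_le_sq₀ (norm_nonneg _) (norm_nonneg _), @norm_sub_sq_real, @norm_sub_sq_real,
      two_smul, inner_add_left, inner_sub_left, real_inner_comm b y, real_inner_comm a y]
    constructor <;> intro h <;> linarith
  rw [this]
  exact convex_halfSpace_le (innerSL ℝ (2 • (b - a))).isLinear _

/-! ### Voronoi cells, their sections, and the position of a trajectory relative to its cell. -/

variable {η : ℝ} {W : Set Space} {P : MarkedPoint η} {φ ψ : Set (MarkedPoint η)}

lemma cell_eq_inter : cell W P φ = W ∩ ⋂ P' ∈ φ, {y | dist y P.1 ≤ dist y P'.1} := by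
  ext y; simp [cell]

lemma convex_cell (hW : Convex ℝ W) : Convex ℝ (cell W P φ) := by
  rw [cell_eq_inter]
  exact hW.inter (convex_iInter₂ fun _ _ => convex_dist_le_dist _ _)

lemma isClosed_cell (hW : IsClosed W) : IsClosed (cell W P φ) := by
  rw [cell_eq_inter]
  exact hW.inter (isClosed_biInter fun _ _ =>
    isClosed_le (by fun_prop) (by fun_prop))

lemma convex_slice {K : Set Space} (hK : Convex ℝ K) (h : ℝ) : Convex ℝ (slice K h) := by
  intro u hu v hv a b ha hb hab
  have := hK hu hv ha hb hab
  have e : a • lift u h + b • lift v h = lift (a • u + b • v) h := by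
    refine space_ext ?_ ?_ ?_ <;> simp
    rw [← add_mul, hab, one_mul]
  rwa [e] at this

lemma isClosed_slice {K : Set Space} (hK : IsClosed K) (h : ℝ) : IsClosed (slice K h) :=
  hK.preimage (continuous_lift.comp (by fun_prop : Continuous fun u : Plane => (u, h)))

lemma isBounded_slice {K : Set Space} (hK : Bornology.IsBounded K) (h : ℝ) :
    Bornology.IsBounded (slice K h) := by
  obtain ⟨C, hC⟩ := Metric.isBounded_iff.1 hK
  exact Metric.isBounded_iff.2 ⟨C, fun u hu v hv => dist_lift u v h ▸ hC hu hv⟩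

lemma integrableOn_id_of_isBounded {K : Set Plane} (hK : Bornology.IsBounded K) :
    IntegrableOn (fun u : Plane => u) K := by
  obtain ⟨C, hC⟩ := hK.exists_norm_le
  refine Measure.integrableOn_of_bounded (M := C) hK.measure_lt_top.ne
    aestronglyMeasurable_id ?_
  exact (ae_restrict_iff (measurableSet_le (by fun_prop) (by fun_prop))).2
    (Eventually.of_forall fun u hu => hC u hu)

lemma centroid_mem {K : Set Plane} (hK : Bornology.IsBounded K) (hc : Convex ℝ K)
    (hcl : IsClosed K) (h0 : 0 < volume K) : centroid K ∈ K :=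
  hc.set_average_mem hcl h0.ne' hK.measure_lt_top.ne
    (ae_restrict_mem hcl.measurableSet) (integrableOn_id_of_isBounded hK)

lemma mem_slice_centroidRule {u : Plane} {h : ℝ} :
    u ∈ slice (centroidRule η W P φ) h ↔ Bornology.IsBounded (cell W P φ) ∧
      ∃ hh : h ∈ unitInterval, 0 < volume (slice (cell W P φ) h) ∧
        u = centroid (slice (cell W P φ) h) + (P.2 ⟨h, hh⟩ : Plane) := by
  constructor
  · rintro ⟨hb, k, hk, e⟩
    obtain ⟨rfl, rfl⟩ := lift_inj.1 e
    exact ⟨hb, k.2, hk, rfl⟩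
  · rintro ⟨hb, hh, hk, rfl⟩
    exact ⟨hb, ⟨h, hh⟩, hk, rfl⟩

/-- The centroid itself serves as `c`. From here on, the stabilization argument uses no other
property of the centroid. -/
lemma exists_mem_cell_of_mem_centroidRule {n : ℕ∞} {u : Plane} {h : ℝ}
    (hu : u ∈ slice (centroidRule η (window n) P φ) h) :
    ∃ c : Plane, lift c h ∈ cell (window n) P φ ∧ dist u c ≤ η := by
  obtain ⟨hb, hh, hk, rfl⟩ := mem_slice_centroidRule.1 hu
  refine ⟨_, centroid_mem (isBounded_slice hb h) (convex_slice (convex_cell (convex_window n)) h)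
    (isClosed_slice (isClosed_cell (isClosed_window n)) h) hk, ?_⟩
  have := (P.2 ⟨h, hh⟩).2
  rwa [dist_eq_norm, add_sub_cancel_left, ← dist_zero_right]

lemma centroidRule_congr (h : cell W P φ = cell W P ψ) :
    centroidRule η W P φ = centroidRule η W P ψ := by
  simp only [centroidRule, h]

/-! ### Stabilization for dense configurations -/

section Deterministic

variable {η : ℝ} {W W' : Set Space} {P : MarkedPoint η} {φ ψ : Set (MarkedPoint η)} {x : Plane}
  {r t δ D M : ℝ}

/-- Every point of `W'` near `Q_{2r}(x)` has a point of `φ` nearby that lies outside `Q_1(x)`. -/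
def IsDense {η : ℝ} (W' : Set Space) (φ : Set (MarkedPoint η)) (x : Plane) (r : ℝ) : Prop :=
  ∀ y ∈ W', hdist x y ≤ 3 / 2 * r → ∃ p ∈ φ, p.1 ∉ box 1 x ∧ dist y p.1 ≤ r / 16

/-- The segment from `P` to a farther `y` in its cell would cross the level `t + δ` at some `z`,
which is at distance at least `δ` from `P`. A point of `ψ` within `D < δ` of `z` is then closer to
`y` than `P` is, because `z` lies on the segment. The larger set `W'` allows a generator outside the
window: points of `ℬ` may stick out of `Q_n`. -/
lemma hdist_le_of_mem_cell (hW : W ⊆ W') (hconv : Convex ℝ W') (hP : P.1 ∈ W')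
    (hPt : hdist x P.1 ≤ t)
    (hd : ∀ y ∈ W', hdist x y ≤ t + δ → ∃ p ∈ ψ, dist y p.1 ≤ D) (hD : D < δ) (hδ : 0 ≤ δ)
    {y : Space} (hy : y ∈ cell W P ψ) : hdist x y ≤ t + δ := by
  by_contra! hlt
  have hseg : IsPreconnected (segment ℝ P.1 y) := (convex_segment _ _).isPreconnected
  obtain ⟨z, hz, hzt⟩ := hseg.intermediate_value (left_mem_segment ℝ P.1 y)
    (right_mem_segment ℝ P.1 y) (continuous_hdist x).continuousOn
    (show t + δ ∈ Set.Icc _ _ from ⟨by linarith, hlt.le⟩)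
  have hzW : z ∈ W' := hconv.segment_subset hP (hW hy.1) hz
  obtain ⟨p, hp, hzp⟩ := hd z hzW hzt.le
  have h1 := hy.2 p hp
  have h2 := dist_add_dist_of_mem_segment hz
  have h3 := dist_triangle y z p.1
  have h4 := hdist_le_add_dist x z P.1
  rw [dist_comm P.1 z, dist_comm P.1 y, dist_comm z y] at h2
  linarith

/-- A location near `x` has a point of `ψ` within `D`, while `P` is farther away than that. -/
lemma lt_hdist_of_mem_cell (hW : W ⊆ W') (hPt : t + D < hdist x P.1)
    (hd : ∀ y ∈ W', hdist x y ≤ t → ∃ p ∈ ψ, dist y p.1 ≤ D)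
    {y : Space} (hy : y ∈ cell W P ψ) : t < hdist x y := by
  by_contra! hle
  obtain ⟨p, hp, hyp⟩ := hd y (hW hy.1) hle
  have h1 := hy.2 p hp
  have h2 := hdist_le_add_dist x P.1 y
  rw [dist_comm] at h2
  linarith

/-- The points of a dense configuration in a box are dense, up to the boundary of the box. -/
lemma IsDense.exists_mem_within (h : IsDense W' φ x r) (hφ : ∀ p ∈ φ, p.1 ∈ slab) {s : ℝ}
    (ht : t ≤ 3 / 2 * r) (hts : t + r / 16 ≤ s / 2) {y : Space} (hy : y ∈ W')
    (hyt : hdist x y ≤ t) :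
    ∃ p ∈ within φ (box s x \ box 1 x), dist y p.1 ≤ r / 16 := by
  obtain ⟨p, hp, hp1, hpd⟩ := h y hy (hyt.trans ht)
  refine ⟨p, ⟨hp, ?_, hp1⟩, hpd⟩
  rw [mem_box_of_mem_slab (hφ p hp)]
  have := hdist_le_add_dist x p.1 y
  rw [dist_comm] at this
  linarith

lemma s1_of_isDense (hW : W ⊆ W') (hslab : W' ⊆ slab) (hconv : Convex ℝ W')
    (hbox : box 1 x ⊆ W') (hφ : ∀ p ∈ φ, p.1 ∈ slab) (h : IsDense W' φ x r) (hr : 4 ≤ r) :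
    S1 (centroidRule η) W φ x r := by
  intro A B hA hB P hP hPr
  apply centroidRule_congr
  have hPA : P ∈ A := by
    rcases hP with hP | hP
    · exact hP
    · exact absurd hP.2 hPr
  have hgP : r / 2 < hdist x P.1 := by
    by_contra! hle
    exact hPr ((mem_box_of_mem_slab (hslab (hW (hA.2 P hPA).1))).2 hle)
  have key : ∀ y ∈ W', hdist x y ≤ 1 / 2 + r / 8 →
      ∃ p ∈ modify₂ φ x r A ∅, dist y p.1 ≤ r / 16 := fun y hy hyt => by
    obtain ⟨p, hp, hpd⟩ := h.exists_mem_within hφ (s := r) (by linarith) (by linarith) hy hyt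
    exact ⟨p, Or.inr hp, hpd⟩
  apply Set.Subset.antisymm
  · intro y hy
    refine ⟨hy.1, fun P' hP' => hy.2 P' ?_⟩
    rcases hP' with (hP' | hP') | hP'
    · exact Or.inl (Or.inl hP')
    · exact hP'.elim
    · exact Or.inr hP'
  · intro y hy
    refine ⟨hy.1, fun b hb => ?_⟩
    rcases hb with (hb | hb) | hb
    · exact hy.2 b (Or.inl (Or.inl hb))
    -- If `b` beats `P` at `y`, then `y` also lies in the cell of `b` competing against the
    -- configuration without `ℬ`. That cell stays near `Q_1(x)`, whereas the cell of `P` stays away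
    -- from it.
    · by_contra! hlt
      have hyb : y ∈ cell W b (modify₂ φ x r A ∅) :=
        ⟨hy.1, fun p hp => hlt.le.trans (hy.2 p hp)⟩
      have hg := hdist_le_of_mem_cell hW hconv (hbox (hB.2 b hb))
        (mem_box.1 (hB.2 b hb)).1 key (by linarith) (by linarith) hyb
      exact absurd hg (not_le.2 (lt_hdist_of_mem_cell hW (by linarith) key hy))
    · exact hy.2 b (Or.inr hb)

lemma s2_of_isDense {n : ℕ∞} (hη : η ≤ 1 / 4) (hW : window n ⊆ W') (hslab : W' ⊆ slab)
    (hconv : Convex ℝ W') (hbox : box 1 x ⊆ W') (hφ : ∀ p ∈ φ, p.1 ∈ window n)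
    (h : IsDense W' φ x r) (hr : 4 ≤ r) (hM : 4 * M + 2 < r) :
    S2 (centroidRule η) M (window n) φ x r := by
  intro A B hA hB P hP P' hP'
  have hφ' : ∀ p ∈ φ, p.1 ∈ slab := fun p hp => hslab (hW (hφ p hp))
  set Ψ := modify₂ φ x (2 * r) A B with hΨ
  have key : ∀ t ≤ 15 / 16 * r, ∀ y ∈ W', hdist x y ≤ t → ∃ p ∈ Ψ, dist y p.1 ≤ r / 16 :=
    fun t ht y hy hyt => by
      obtain ⟨p, hp, hpd⟩ := h.exists_mem_within hφ' (s := 2 * r) (by linarith) (by linarith) hy hyt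
      exact ⟨p, Or.inr hp, hpd⟩
  have hgP : r < hdist x P.1 := by
    by_contra! hle
    refine (hA.2 P hP).2 ((mem_box_of_mem_slab (hslab (hW (hA.2 P hP).1))).2 ?_)
    linarith
  have hgP' := (mem_box.1 hP'.2).1
  have hP'W : P'.1 ∈ W' := by
    rcases hP'.1 with (hq | hq) | hq
    · exact hW (hA.2 _ hq).1
    · exact hbox (hB.2 _ hq)
    · exact hW (hφ _ hq.1)
  have h1 : ∀ y ∈ cell (window n) P Ψ, 7 / 8 * r < hdist x y := fun y hy =>
    lt_hdist_of_mem_cell hW (D := r / 16) (by linarith) (key _ (by linarith)) hy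
  have h2 : ∀ y ∈ cell (window n) P' Ψ, hdist x y ≤ r / 2 + r / 8 := fun y hy =>
    hdist_le_of_mem_cell hW hconv hP'W hgP' (key _ (by linarith)) (by linarith) (by linarith) hy
  -- The two cells are separated by `7r/8 - 5r/8 = r/4`, and the two noises cost at most `2η ≤ 1/2`.
  refine lt_of_lt_of_le (b := ENNReal.ofReal (r / 4 - 1 / 2))
    ((ENNReal.ofReal_lt_ofReal_iff (by linarith)).2 (by linarith)) ?_
  refine le_iInf fun k => le_iInf₂ fun u hu => le_iInf₂ fun v hv => ?_
  obtain ⟨c, hc, hcu⟩ := exists_mem_cell_of_mem_centroidRule hu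
  obtain ⟨d, hd, hdv⟩ := exists_mem_cell_of_mem_centroidRule hv
  have := h1 _ hc
  have := h2 _ hd
  have h5 := hdist_le_add_dist x (lift c k) (lift d k)
  rw [dist_lift] at h5
  rw [edist_dist]
  apply ENNReal.ofReal_le_ofReal
  have h6 := dist_triangle4 c u v d
  rw [dist_comm c u] at h6
  linarith

/-- Since `A` only adds competitors, the bounds hold for every `A`. The second one shows that points
at distance more than `r / 16` from the cell cannot cut into it. -/
lemma s3_aux {n : ℕ∞} (hW : window n ⊆ W') (hslab : W' ⊆ slab)
    (hconv : Convex ℝ W') (hφ : ∀ p ∈ φ, p.1 ∈ window n)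
    (h : IsDense W' φ x r) (hr : 4 ≤ r) {P : MarkedPoint η} (hP : P ∈ within φ (box (2 * r) x))
    (A : Set (MarkedPoint η)) {y : Space} (hy : y ∈ cell (window n) P (modify φ x (4 * r) A)) :
    hdist x y ≤ r + r / 8 ∧ dist y P.1 ≤ r / 16 := by
  have hφ' : ∀ p ∈ φ, p.1 ∈ slab := fun p hp => hslab (hW (hφ p hp))
  have key : ∀ y ∈ W', hdist x y ≤ r + r / 8 →
      ∃ p ∈ modify φ x (4 * r) A, dist y p.1 ≤ r / 16 :=
    fun y hy hyt => by
      obtain ⟨p, hp, hpd⟩ := h.exists_mem_within hφ' (s := 4 * r) (by linarith) (by linarith) hy hyt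
      exact ⟨p, Or.inr ⟨hp.1, hp.2.1⟩, hpd⟩
  have hle : hdist x y ≤ r + r / 8 := hdist_le_of_mem_cell hW hconv (hW (hφ P hP.1))
    ((mem_box.1 hP.2).1.trans (by linarith)) key (by linarith) (by linarith) hy
  obtain ⟨p, hp, hpd⟩ := key y (hW hy.1) hle
  exact ⟨hle, (hy.2 p hp).trans hpd⟩

lemma s3_of_isDense {n : ℕ∞} (hW : window n ⊆ W') (hslab : W' ⊆ slab)
    (hconv : Convex ℝ W') (hφ : ∀ p ∈ φ, p.1 ∈ window n)
    (h : IsDense W' φ x r) (hr : 4 ≤ r) : S3 (centroidRule η) (window n) φ x r := by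
  intro A hA P hP
  apply centroidRule_congr
  apply Set.Subset.antisymm
  · intro y hy
    refine ⟨hy.1, fun P' hP' => hy.2 P' ?_⟩
    rcases hP' with hP' | hP'
    · exact hP'.elim
    · exact Or.inr hP'
  · intro y hy
    refine ⟨hy.1, fun a ha => ?_⟩
    rcases ha with ha | ha
    · have := s3_aux hW hslab hconv hφ h hr hP ∅ hy
      have hga : 2 * r < hdist x a.1 := by
        by_contra! hle
        refine (hA.2 a ha).2 ((mem_box_of_mem_slab (hslab (hW (hA.2 a ha).1))).2 ?_)
        linarith
      have h2 := hdist_le_add_dist x a.1 y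
      rw [dist_comm] at h2
      linarith
    · exact hy.2 a (Or.inr ha)

lemma s3'_of_isDense {n : ℕ∞} (hη : η ≤ 1 / 4) (hW : window n ⊆ W') (hslab : W' ⊆ slab)
    (hconv : Convex ℝ W') (hφ : ∀ p ∈ φ, p.1 ∈ window n)
    (h : IsDense W' φ x r) (hr : 4 ≤ r) : S3' (centroidRule η) (window n) φ x r := by
  intro A _ P hP y hy
  obtain ⟨u, hu⟩ := exists_eq_lift y
  obtain ⟨c, hc, hcu⟩ := exists_mem_cell_of_mem_centroidRule
    (show u ∈ slice (centroidRule η (window n) P (modify φ x (4 * r) A)) (y 2) by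
      rw [hu] at hy; exact hy)
  have h1 := (s3_aux hW hslab hconv hφ h hr hP A hc).1
  have h2 := hdist_le_add_dist x (lift u (y 2)) (lift c (y 2))
  rw [dist_lift] at h2
  have h3 := mem_slab.1 (window_subset_slab n hc.1)
  rw [lift_two] at h3
  rw [mem_box, hu]
  simp only [lift_two]
  exact ⟨by linarith, h3⟩

theorem stabilizes_of_isDense {n : ℕ∞} (hη : η ≤ 1 / 4) (hW : window n ⊆ W') (hslab : W' ⊆ slab)
    (hconv : Convex ℝ W') (hbox : box 1 x ⊆ W') (hφ : ∀ p ∈ φ, p.1 ∈ window n)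
    (h : IsDense W' φ x r) (hr : 4 ≤ r) (hM : 4 * M + 2 < r) :
    Stabilizes (centroidRule η) M n φ x r :=
  ⟨s1_of_isDense hW hslab hconv hbox (fun p hp => hslab (hW (hφ p hp))) h hr,
    s2_of_isDense hη hW hslab hconv hbox hφ h hr hM,
    s3_of_isDense hW hslab hconv hφ h hr,
    fun _ => s3'_of_isDense hη hW hslab hconv hφ h hr⟩

/-- No room is left for `𝒜`, so every condition is vacuous or an identity. -/
theorem stabilizes_of_window_subset {n : ℕ} (hr : 0 ≤ r) (h : window n ⊆ box r x) :
    Stabilizes (centroidRule η) M n φ x r := by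
  have hmono : ∀ s, r ≤ s → window n ⊆ box s x := fun s hs y hy => by
    have := mem_box.1 (h hy)
    exact mem_box.2 ⟨by linarith [this.1], this.2⟩
  have hempty : ∀ s, r ≤ s → ∀ A : Set (MarkedPoint η), FiniteIn (window n \ box s x) A → A = ∅ :=
    fun s hs A hA => Set.eq_empty_of_forall_notMem fun P hP =>
      (hA.2 P hP).2 (hmono s hs (hA.2 P hP).1)
  refine ⟨?_, ?_, ?_, fun h => absurd h (by simp)⟩
  · intro A B hA hB P hP hPr
    rw [hempty r le_rfl A hA] at hP
    rcases hP with hP | hP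
    · exact hP.elim
    · exact absurd hP.2 hPr
  · intro A B hA hB P hP
    rw [hempty _ (by linarith) A hA] at hP
    exact hP.elim
  · intro A hA P hP
    rw [hempty _ (by linarith) A hA]

end Deterministic

/-! ### Translation covariance -/

section Translation

variable {η : ℝ} {W : Set Space} {P : MarkedPoint η} {φ : Set (MarkedPoint η)}

lemma lift_add_lift (u v : Plane) (h : ℝ) : lift u h + lift v 0 = lift (u + v) h :=
  space_ext (by simp) (by simp) (by simp)

lemma slice_translate (K : Set Space) (v : Plane) (h : ℝ) :
    slice ((fun y => y + lift v 0) '' K) h = (fun u => u + v) '' slice K h := by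
  ext u
  constructor
  · rintro ⟨y, hy, e⟩
    have e' : lift (u - v) h = y := by
      rw [← add_left_inj (lift v 0), lift_add_lift, sub_add_cancel, ← e]
    exact ⟨u - v, show lift (u - v) h ∈ K from e' ▸ hy, sub_add_cancel u v⟩
  · rintro ⟨w, hw, rfl⟩
    exact ⟨lift w h, hw, lift_add_lift w v h⟩

lemma cell_translate (a : Space) :
    cell ((fun y => y + a) '' W) (P.1 + a, P.2)
      ((fun P' : MarkedPoint η => (P'.1 + a, P'.2)) '' φ) = (fun y => y + a) '' cell W P φ := by
  ext y
  constructor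
  · rintro ⟨⟨w, hw, rfl⟩, h⟩
    refine ⟨w, ⟨hw, fun P' hP' => ?_⟩, rfl⟩
    simpa using h _ (Set.mem_image_of_mem _ hP')
  · rintro ⟨w, hw, rfl⟩
    refine ⟨⟨w, hw.1, rfl⟩, ?_⟩
    rintro _ ⟨P', hP', rfl⟩
    simpa using hw.2 P' hP'

lemma isBounded_translate {E : Type*} [SeminormedAddCommGroup E] {K : Set E} (a : E) :
    Bornology.IsBounded ((fun y => y + a) '' K) ↔ Bornology.IsBounded K := by
  rw [Metric.isBounded_image_iff, Metric.isBounded_iff]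
  simp

lemma volume_translate (K : Set Plane) (v : Plane) :
    volume ((fun u => u + v) '' K) = volume K := by
  rw [Set.image_add_right, measure_preimage_add_right]

lemma centroid_translate {K : Set Plane} (hK : Bornology.IsBounded K) (h0 : 0 < volume K)
    (v : Plane) : centroid ((fun u => u + v) '' K) = centroid K + v := by
  have hfin : volume K ≠ ∞ := hK.measure_lt_top.ne
  have hpos : volume.real K ≠ 0 := (ENNReal.toReal_pos h0.ne' hfin).ne'
  have hint := integrableOn_id_of_isBounded hK
  unfold centroid
  rw [setAverage_eq, setAverage_eq,
    (measurePreserving_add_right volume v).setIntegral_image_emb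
      (MeasurableEquiv.addRight v).measurableEmbedding,
    integral_add hint (integrableOn_const hfin), setIntegral_const, smul_add,
    measureReal_def, volume_translate, ← measureReal_def, smul_smul, inv_mul_cancel₀ hpos, one_smul]

theorem translationCovariant_centroidRule (η : ℝ) : TranslationCovariant (centroidRule η) := by
  intro v W P φ
  have key : ∀ u h, u ∈ slice (centroidRule η ((fun y => y + lift v 0) '' W) (P.1 + lift v 0, P.2)
        ((fun P' : MarkedPoint η => (P'.1 + lift v 0, P'.2)) '' φ)) h ↔
      u ∈ (fun u => u + v) '' slice (centroidRule η W P φ) h := by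
    intro u h
    rw [mem_slice_centroidRule, cell_translate, slice_translate, isBounded_translate,
      volume_translate]
    constructor
    · rintro ⟨hb, hh, hk, rfl⟩
      refine ⟨_, mem_slice_centroidRule.2 ⟨hb, hh, hk, rfl⟩, ?_⟩
      rw [centroid_translate (isBounded_slice hb h) hk]
      exact add_right_comm _ _ _
    · rintro ⟨w, hw, rfl⟩
      obtain ⟨hb, hh, hk, rfl⟩ := mem_slice_centroidRule.1 hw
      refine ⟨hb, hh, hk, ?_⟩
      rw [centroid_translate (isBounded_slice hb h) hk]
      exact add_right_comm _ _ _
  ext y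
  obtain ⟨u, hu⟩ := exists_eq_lift y
  rw [hu]
  exact (key u (y 2)).trans (by rw [← slice_translate]; rfl)

end Translation

/-! ### Measurability -/

section Measurability

variable {Θ : Type*} [MeasurableSpace Θ]

lemma measurable_lift (h : ℝ) : Measurable fun u : Plane => lift u h :=
  (continuous_lift.comp (by fun_prop : Continuous fun u : Plane => (u, h))).measurable

/-- By Fubini, both the area of the section and its first moment are measurable in the parameter. -/
lemma measurable_centroid {S : Set (Θ × Plane)} (hS : MeasurableSet S) :
    Measurable fun θ => centroid {u | (θ, u) ∈ S} := by
  have hsec : ∀ θ, MeasurableSet {u | (θ, u) ∈ S} := fun θ => measurable_prodMk_left hS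
  have h1 : Measurable fun θ => volume {u | (θ, u) ∈ S} := measurable_measure_prodMk_left hS
  have h2 : Measurable fun θ => ∫ u, S.indicator (fun p => p.2) (θ, u) := by
    have : StronglyMeasurable (S.indicator (fun p : Θ × Plane => p.2)) :=
      (measurable_snd.indicator hS).stronglyMeasurable
    exact (StronglyMeasurable.integral_prod_right (ν := volume)
      (f := fun θ u => S.indicator (fun p : Θ × Plane => p.2) (θ, u)) this).measurable
  have : (fun θ => centroid {u | (θ, u) ∈ S}) = fun θ =>
      (volume {u | (θ, u) ∈ S}).toReal⁻¹ • ∫ u, S.indicator (fun p => p.2) (θ, u) := by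
    ext1 θ
    unfold centroid
    rw [setAverage_eq, measureReal_def, ← integral_indicator (hsec θ)]
    rfl
  rw [this]
  exact h1.ennreal_toReal.inv.smul h2

/-- The cell of the location `q θ` in a parametrized family of countably many locations `p i θ`, of
which only those with `θ ∈ I i` are taken into account. -/
lemma measurableSet_parametrized_cell {ι : Type*} [Countable ι] {W : Set Space}
    (hW : MeasurableSet W) {q : Θ → Space} (hq : Measurable q) {p : ι → Θ → Space}
    (hp : ∀ i, Measurable (p i)) {I : ι → Set Θ} (hI : ∀ i, MeasurableSet (I i)) :
    MeasurableSet {z : Θ × Space | z.2 ∈ W ∧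
      ∀ i, z.1 ∈ I i → dist z.2 (q z.1) ≤ dist z.2 (p i z.1)} := by
  have : {z : Θ × Space | z.2 ∈ W ∧ ∀ i, z.1 ∈ I i → dist z.2 (q z.1) ≤ dist z.2 (p i z.1)} =
      Prod.snd ⁻¹' W ∩ ⋂ i, ((Prod.fst ⁻¹' (I i))ᶜ ∪
        {z | dist z.2 (q z.1) ≤ dist z.2 (p i z.1)}) := by
    ext z
    simp [imp_iff_not_or]
  rw [this]
  refine (measurable_snd hW).inter (MeasurableSet.iInter fun i =>
    ((measurable_fst (hI i)).compl).union (measurableSet_le ?_ ?_))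
  · exact measurable_snd.dist (hq.comp measurable_fst)
  · exact measurable_snd.dist ((hp i).comp measurable_fst)

lemma measurableSet_parametrized_slice {S : Set (Θ × Space)} (hS : MeasurableSet S) (h : ℝ) :
    MeasurableSet {z : Θ × Plane | (z.1, lift z.2 h) ∈ S} :=
  (measurable_fst.prodMk ((measurable_lift h).comp measurable_snd)) hS

lemma measurableSet_of_isSigmaCompact {X : Type*} [TopologicalSpace X] [T2Space X]
    [MeasurableSpace X] [OpensMeasurableSpace X] {s : Set X} (hs : IsSigmaCompact s) :
    MeasurableSet s := by
  obtain ⟨K, hK, rfl⟩ := hs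
  exact MeasurableSet.iUnion fun n => (hK n).measurableSet

/-- Unboundedness means meeting `{R ≤ ‖y‖}` for every `R`. The parameters for which this happens
form a projection of a closed, hence σ-compact, set, and a continuous image of a σ-compact set is
σ-compact. -/
lemma measurableSet_isBounded_section {Y : Type*} [TopologicalSpace Y] [T2Space Y]
    [SigmaCompactSpace Y] [MeasurableSpace Y] [OpensMeasurableSpace Y]
    {S : Set (Y × Space)} (hS : IsClosed S) :
    MeasurableSet {θ : Y | Bornology.IsBounded {y | (θ, y) ∈ S}} := by
  have : {θ : Y | Bornology.IsBounded {y | (θ, y) ∈ S}} =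
      (⋂ R : ℕ, Prod.fst '' (S ∩ {z | (R : ℝ) ≤ ‖z.2‖}))ᶜ := by
    ext θ
    simp only [Set.mem_compl_iff, Set.mem_iInter, not_forall, Set.mem_ofPred_eq]
    constructor
    · intro hb
      obtain ⟨C, hC⟩ := hb.exists_norm_le
      obtain ⟨R, hR⟩ := exists_nat_gt C
      refine ⟨R, ?_⟩
      rintro ⟨⟨θ', y⟩, ⟨hy, hle⟩, rfl⟩
      have h1 : ‖y‖ ≤ C := hC y hy
      have h2 : (R : ℝ) ≤ ‖y‖ := hle
      linarith
    · rintro ⟨R, hR⟩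
      refine isBounded_iff_forall_norm_le.2 ⟨R, fun y hy => ?_⟩
      by_contra! hlt
      exact hR ⟨(θ, y), ⟨hy, hlt.le⟩, rfl⟩
  rw [this]
  refine (MeasurableSet.iInter fun R => ?_).compl
  refine measurableSet_of_isSigmaCompact (IsSigmaCompact.image continuous_fst ?_)
  have hc : IsClosed (S ∩ {z | (R : ℝ) ≤ ‖z.2‖}) :=
    hS.inter (isClosed_le continuous_const (by fun_prop))
  exact isSigmaCompact_univ.of_isClosed_subset hc (Set.subset_univ _)

lemma cell_range {η : ℝ} {k : ℕ} (W : Set Space) (p : Fin (k + 1) → MarkedPoint η) :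
    cell W (p 0) (Set.range p) = {y | y ∈ W ∧ ∀ i, dist y (p 0).1 ≤ dist y (p i).1} := by
  ext y; simp [cell]

lemma measurableSet_isBounded_cell {η : ℝ} (n : ℕ∞) (k : ℕ) :
    MeasurableSet {p : Fin (k + 1) → MarkedPoint η |
      Bornology.IsBounded (cell (window n) (p 0) (Set.range p))} := by
  have hcl : IsClosed {z : (Fin (k + 1) → Space) × Space | z.2 ∈ window n ∧
      ∀ i, dist z.2 (z.1 0) ≤ dist z.2 (z.1 i)} := by
    have : {z : (Fin (k + 1) → Space) × Space | z.2 ∈ window n ∧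
        ∀ i, dist z.2 (z.1 0) ≤ dist z.2 (z.1 i)} = Prod.snd ⁻¹' window n ∩
          ⋂ i, {z : (Fin (k + 1) → Space) × Space | dist z.2 (z.1 0) ≤ dist z.2 (z.1 i)} := by
      ext z; simp
    rw [this]
    exact ((isClosed_window n).preimage continuous_snd).inter
      (isClosed_iInter fun i => isClosed_le (by fun_prop) (by fun_prop))
  -- The topological argument takes place on the locations, a σ-compact space; the noise paths do
  -- not enter the cell and are forgotten.
  have hm : Measurable fun p : Fin (k + 1) → MarkedPoint η => fun i => (p i).1 :=
    measurable_pi_lambda _ fun i => measurable_fst.comp (measurable_pi_apply i)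
  have := hm (measurableSet_isBounded_section hcl)
  convert this using 1
  ext p
  rw [Set.mem_ofPred_eq, cell_range]
  rfl

theorem measurableRule_centroidRule (η : ℝ) : MeasurableRule (centroidRule η) := by
  intro n k h A hA
  by_cases hh : h ∈ unitInterval
  swap
  · convert MeasurableSet.empty
    ext p
    simp only [Set.mem_ofPred_eq, Set.mem_empty_iff_false, iff_false, not_exists, not_and]
    intro u _ hu
    exact hh (mem_slice_centroidRule.1 hu).2.1
  have hloc : ∀ i, Measurable fun p : Fin (k + 1) → MarkedPoint η => (p i).1 :=
    fun i => measurable_fst.comp (measurable_pi_apply i)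
  have hS := measurableSet_parametrized_slice (measurableSet_parametrized_cell
    (isClosed_window n).measurableSet (hloc 0) hloc (fun _ => MeasurableSet.univ)) h
  have hsl : ∀ p : Fin (k + 1) → MarkedPoint η, slice (cell (window n) (p 0) (Set.range p)) h =
      {u | (p, u) ∈ {z : (Fin (k + 1) → MarkedPoint η) × Plane |
        (z.1, lift z.2 h) ∈ {z : (Fin (k + 1) → MarkedPoint η) × Space | z.2 ∈ window n ∧
          ∀ i, z.1 ∈ Set.univ → dist z.2 (z.1 0).1 ≤ dist z.2 (z.1 i).1}}} := by
    intro p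
    rw [cell_range]
    ext u
    simp [slice]
  have hvol := measurable_measure_prodMk_left (ν := (volume : Measure Plane)) hS
  have hcen := measurable_centroid hS
  have hnoise : Measurable fun p : Fin (k + 1) → MarkedPoint η => ((p 0).2 ⟨h, hh⟩ : Plane) :=
    measurable_subtype_coe.comp ((measurable_pi_apply _).comp
      (measurable_snd.comp (measurable_pi_apply 0)))
  have := (measurableSet_isBounded_cell (η := η) n k).inter
    ((measurableSet_lt (measurable_const (a := (0 : ℝ≥0∞))) hvol).inter ((hcen.add hnoise) hA))
  convert this using 1
  ext p
  simp only [Set.mem_ofPred_eq, mem_slice_centroidRule, Set.mem_inter_iff, Set.mem_preimage,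
    Pi.add_apply]
  rw [hsl]
  constructor
  · rintro ⟨u, hu, hb, _, hv, rfl⟩
    exact ⟨hb, hv, hu⟩
  · rintro ⟨hb, hv, hu⟩
    exact ⟨_, hu, hb, hh, hv, rfl⟩

end Measurability

/-! ### Volumes -/

lemma volume_box {s : ℝ} (hs : 0 ≤ s) (x : Plane) : volume (box s x) = ENNReal.ofReal (s ^ 2) := by
  have : box s x = (fun y : Space => WithLp.ofLp y) ⁻¹'
      Set.Icc ![x 0 - s / 2, x 1 - s / 2, 0] ![x 0 + s / 2, x 1 + s / 2, 1] := by
    ext y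
    rw [mem_box, hdist_le, Set.mem_preimage, Set.mem_Icc (a := ![_, _, _]), Pi.le_def, Pi.le_def]
    simp only [Fin.forall_fin_succ, abs_le, Set.mem_Icc]
    simp
    constructor
    · rintro ⟨⟨⟨_, _⟩, _, _⟩, _, _⟩
      refine ⟨⟨?_, ?_, ?_⟩, ?_, ?_, ?_⟩ <;> linarith
    · rintro ⟨⟨_, _, _⟩, _, _, _⟩
      refine ⟨⟨⟨?_, ?_⟩, ?_, ?_⟩, ?_, ?_⟩ <;> linarith
  rw [this, (PiLp.volume_preserving_ofLp (Fin 3)).measure_preimage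
    measurableSet_Icc.nullMeasurableSet, Real.volume_Icc_pi, Fin.prod_univ_three]
  simp
  rw [← ENNReal.ofReal_mul hs, sq]

lemma measurableSet_box (s : ℝ) (x : Plane) : MeasurableSet (box s x) :=
  (isClosed_box s x).measurableSet

lemma volume_box_inter_slab_ne_top (s : ℝ) (x : Plane) : volume (box s x ∩ slab) ≠ ∞ :=
  ((measure_mono Set.inter_subset_left).trans_lt (isBounded_box s x).measure_lt_top).ne

/-! ### Poisson processes -/

section Poisson

lemma count_eq_zero {Ω : Type*} {pt : ℕ → Ω → Space} {B : Set Space} {ω : Ω} :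
    count pt B ω = 0 ↔ ∀ i, pt i ω ∉ B := by
  rw [count, Set.encard_eq_zero, Set.eq_empty_iff_forall_notMem]; rfl

variable {Ω : Type*} [MeasurableSpace Ω] {μ : Measure Ω} {lam : ℝ≥0} {pt : ℕ → Ω → Space}
  {B B' : Set Space}

lemma IsPoissonProcess.aemeasurable_count (hpt : IsPoissonProcess μ lam pt)
    (hB : MeasurableSet B) (hfin : volume (B ∩ slab) ≠ ∞) : AEMeasurable (count pt B) μ := by
  by_contra h
  have h1 := hpt.law B hB hfin
  -- The image measure would be zero by convention, but it is a Poisson law.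
  rw [Measure.map_of_not_aemeasurable h] at h1
  exact IsProbabilityMeasure.ne_zero _ h1.symm

lemma IsPoissonProcess.lintegral_count (hpt : IsPoissonProcess μ lam pt)
    (hB : MeasurableSet B) (hfin : volume (B ∩ slab) ≠ ∞) (g : ℕ∞ → ℝ≥0∞) :
    ∫⁻ ω, g (count pt B ω) ∂μ = ∑' k : ℕ, ENNReal.ofReal
      (Real.exp (-(lam * (volume (B ∩ slab)).toReal)) * (lam * (volume (B ∩ slab)).toReal) ^ k /
        k.factorial) * g k := by
  rw [← lintegral_map' (μ := μ) (f := g) (g := count pt B) (Measurable.of_discrete.aemeasurable)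
    (hpt.aemeasurable_count hB hfin), hpt.law B hB hfin,
    lintegral_map Measurable.of_discrete Measurable.of_discrete, poissonMeasure,
    lintegral_sum_measure]
  refine tsum_congr fun k => ?_
  rw [lintegral_smul_measure, lintegral_dirac, smul_eq_mul, NNReal.coe_mul]
  rfl

/-- The moment is dominated by the generating function: `E[b ^ N] = exp (a (b - 1))` for a Poisson
variable `N` of mean `a`. -/
lemma IsPoissonProcess.lintegral_pow_count_le (hpt : IsPoissonProcess μ lam pt)
    (hB : MeasurableSet B) (hfin : volume (B ∩ slab) ≠ ∞) {m : ℕ} {K b : ℝ}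
    (hK : 0 ≤ K) (hb : 0 ≤ b) (hKb : ∀ k : ℕ, (k : ℝ) ^ m ≤ K * b ^ k) :
    ∫⁻ ω, ((count pt B ω : ℕ∞) : ℝ≥0∞) ^ m ∂μ ≤
      ENNReal.ofReal (K * Real.exp (lam * (volume (B ∩ slab)).toReal * (b - 1))) := by
  rw [hpt.lintegral_count hB hfin fun k => (k : ℝ≥0∞) ^ m]
  set a : ℝ := lam * (volume (B ∩ slab)).toReal with ha
  have ha0 : 0 ≤ a := by positivity
  have hs : HasSum (fun k : ℕ => K * Real.exp (-a) * ((a * b) ^ k / k.factorial))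
      (K * Real.exp (-a) * Real.exp (a * b)) := by
    have := (NormedSpace.expSeries_div_hasSum_exp (a * b)).mul_left (K * Real.exp (-a))
    rwa [← Real.exp_eq_exp_ℝ] at this
  have e : K * Real.exp (a * (b - 1)) = K * Real.exp (-a) * Real.exp (a * b) := by
    rw [mul_assoc K, ← Real.exp_add]; congr 2; ring
  rw [e, ← hs.tsum_eq, ENNReal.ofReal_tsum_of_nonneg (fun k => by positivity) hs.summable]
  refine ENNReal.tsum_le_tsum fun k => ?_
  have : ((k : ℕ∞) : ℝ≥0∞) ^ m = ENNReal.ofReal ((k : ℝ) ^ m) := by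
    rw [ENNReal.ofReal_pow (by positivity)]; simp
  rw [this, ← ENNReal.ofReal_mul (by positivity)]
  apply ENNReal.ofReal_le_ofReal
  calc Real.exp (-a) * a ^ k / k.factorial * (k : ℝ) ^ m
      ≤ Real.exp (-a) * a ^ k / k.factorial * (K * b ^ k) := by gcongr; exact hKb k
    _ = K * Real.exp (-a) * ((a * b) ^ k / k.factorial) := by rw [mul_pow]; ring

lemma IsPoissonProcess.measure_count_eq_zero (hpt : IsPoissonProcess μ lam pt)
    (hB : MeasurableSet B) (hfin : volume (B ∩ slab) ≠ ∞) :
    μ {ω | count pt B ω = 0} =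
      ENNReal.ofReal (Real.exp (-(lam * (volume (B ∩ slab)).toReal))) := by
  have h1 := Measure.map_apply_of_aemeasurable (hpt.aemeasurable_count hB hfin)
    (measurableSet_singleton (0 : ℕ∞))
  rw [hpt.law B hB hfin, Measure.map_apply Measurable.of_discrete (measurableSet_singleton _)] at h1
  have h2 : (fun k : ℕ => (k : ℕ∞)) ⁻¹' {0} = {0} := by ext k; simp
  rw [h2, poissonMeasure_singleton] at h1
  refine Eq.trans ?_ (h1.symm.trans ?_)
  · rfl
  · rw [pow_zero, mul_one, Nat.factorial_zero, Nat.cast_one, div_one, NNReal.coe_mul]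
    rfl

lemma IsPoissonProcess.indepFun_count (hpt : IsPoissonProcess μ lam pt) (hB : MeasurableSet B)
    (hB' : MeasurableSet B') (h : Disjoint B B') : IndepFun (count pt B) (count pt B') μ := by
  have := hpt.indep 2 ![B, B'] (by simp [Fin.forall_fin_two, hB, hB']) (by
    intro i j hij
    fin_cases i <;> fin_cases j <;> simp_all [disjoint_comm])
  simpa using this.indepFun (show (0 : Fin 2) ≠ 1 by decide)

/-- The contribution of the points in `B'` to the moments, on the event that `B` is void. -/
lemma IsPoissonProcess.lintegral_void_mul_pow_le (hpt : IsPoissonProcess μ lam pt)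
    (hB : MeasurableSet B) (hfin : volume (B ∩ slab) ≠ ∞)
    (hB' : MeasurableSet B') (hfin' : volume (B' ∩ slab) ≠ ∞) {m : ℕ} {K b : ℝ}
    (hK : 0 ≤ K) (hb : 1 ≤ b) (hKb : ∀ k : ℕ, (k : ℝ) ^ m ≤ K * b ^ k) :
    ∫⁻ ω, {ω | count pt B ω = 0}.indicator (fun ω => ((count pt B' ω : ℕ∞) : ℝ≥0∞) ^ m) ω ∂μ ≤
      ENNReal.ofReal (K * Real.exp (lam * ((volume (B' ∩ slab)).toReal * (b - 1) -
        (volume (B ∩ slab)).toReal))) := by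
  -- When `B` is void, the count of `B'` is that of `B' \ B`, which is independent of the count of
  -- `B`.
  have hd : MeasurableSet (B' \ B) := hB'.diff hB
  have hsub : volume (B' \ B ∩ slab) ≤ volume (B' ∩ slab) :=
    measure_mono (Set.inter_subset_inter_left _ Set.sdiff_subset)
  have hfd : volume (B' \ B ∩ slab) ≠ ∞ := (hsub.trans_lt hfin'.lt_top).ne
  have hle : ∀ ω, {ω | count pt B ω = 0}.indicator
      (fun ω => ((count pt B' ω : ℕ∞) : ℝ≥0∞) ^ m) ω ≤
      ({0} : Set ℕ∞).indicator 1 (count pt B ω) * ((count pt (B' \ B) ω : ℕ∞) : ℝ≥0∞) ^ m := by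
    intro ω
    by_cases h0 : count pt B ω = 0
    · rw [Set.indicator_of_mem (show ω ∈ {ω | count pt B ω = 0} from h0), h0]
      simp only [Set.mem_singleton_iff, Set.indicator_of_mem, Pi.one_apply, one_mul]
      gcongr
      exact Set.encard_le_encard fun i hi => ⟨hi, count_eq_zero.1 h0 i⟩
    · rw [Set.indicator_of_notMem (show ω ∉ {ω | count pt B ω = 0} from h0)]
      exact zero_le
  refine (lintegral_mono hle).trans ?_
  have hind := (hpt.indepFun_count hB hd Set.disjoint_sdiff_right).comp
    (Measurable.of_discrete (f := ({0} : Set ℕ∞).indicator (1 : ℕ∞ → ℝ≥0∞)))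
    (Measurable.of_discrete (f := fun k : ℕ∞ => (k : ℝ≥0∞) ^ m))
  have hm1 : AEMeasurable (({0} : Set ℕ∞).indicator (1 : ℕ∞ → ℝ≥0∞) ∘ count pt B) μ :=
    Measurable.of_discrete.comp_aemeasurable (hpt.aemeasurable_count hB hfin)
  have hm2 : AEMeasurable ((fun k : ℕ∞ => (k : ℝ≥0∞) ^ m) ∘ count pt (B' \ B)) μ :=
    Measurable.of_discrete.comp_aemeasurable (hpt.aemeasurable_count hd hfd)
  have hprod := lintegral_mul_eq_lintegral_mul_lintegral_of_indepFun'' hm1 hm2 hind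
  have h1 : ∫⁻ ω, (({0} : Set ℕ∞).indicator (1 : ℕ∞ → ℝ≥0∞) ∘ count pt B) ω ∂μ =
      ENNReal.ofReal (Real.exp (-(lam * (volume (B ∩ slab)).toReal))) := by
    rw [← hpt.measure_count_eq_zero hB hfin]
    have hn : NullMeasurableSet {ω | count pt B ω = 0} μ :=
      (hpt.aemeasurable_count hB hfin).nullMeasurable (measurableSet_singleton 0)
    rw [← lintegral_indicator_one₀ hn]
    rfl
  refine hprod.le.trans ?_
  rw [h1]
  refine (mul_le_mul_right (hpt.lintegral_pow_count_le hd hfd hK (by linarith) hKb) _).trans ?_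
  rw [← ENNReal.ofReal_mul (Real.exp_pos _).le]
  apply ENNReal.ofReal_le_ofReal
  have e : ∀ a c : ℝ, Real.exp (-a) * (K * Real.exp c) = K * Real.exp (c - a) := fun a c => by
    rw [sub_eq_add_neg, Real.exp_add]; ring
  rw [e]
  gcongr
  have : (volume (B' \ B ∩ slab)).toReal ≤ (volume (B' ∩ slab)).toReal :=
    ENNReal.toReal_mono hfin' hsub
  have h3 : (volume (B' \ B ∩ slab)).toReal * (b - 1) ≤ (volume (B' ∩ slab)).toReal * (b - 1) := by
    gcongr
  have := mul_le_mul_of_nonneg_left h3 lam.2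
  simp only [NNReal.val_eq_coe] at this
  linarith

lemma exists_pow_le_mul_pow (m : ℕ) {b : ℝ} (hb : 1 < b) :
    ∃ K : ℝ, 0 ≤ K ∧ ∀ k : ℕ, (k : ℝ) ^ m ≤ K * b ^ k := by
  obtain ⟨K, hK⟩ := (tendsto_pow_const_div_const_pow_of_one_lt m hb).bddAbove_range
  refine ⟨K, ?_, fun k => ?_⟩
  · exact le_trans (by positivity) (hK ⟨0, rfl⟩)
  · have : (k : ℝ) ^ m / b ^ k ≤ K := hK ⟨k, rfl⟩
    rwa [div_le_iff₀ (by positivity)] at this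

/-- Moments of the number of points in growing sets `A r`, up to the first `r` for which another
growing set `B r` contains a point. -/
theorem IsPoissonProcess.exists_sum_lintegral_void_mul_pow_le (hpt : IsPoissonProcess μ lam pt)
    (hlam : 0 < lam) (m : ℕ) : ∃ C : ℝ, 0 < C ∧ ∀ (n : ℕ) (A B : ℕ → Set Space),
      (∀ r < n, MeasurableSet (A r)) → (∀ r < n, MeasurableSet (B r)) →
      (∀ r < n, volume (A r ∩ slab) ≤ ENNReal.ofReal (64 * ((r : ℝ) + 1) ^ 2)) →
      (∀ r < n, ENNReal.ofReal ((r : ℝ) ^ 2) ≤ volume (B r ∩ slab)) →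
      (∀ r < n, volume (B r ∩ slab) ≠ ∞) →
      ∑ r ∈ Finset.range n, ∫⁻ ω, {ω | count pt (B r) ω = 0}.indicator
        (fun ω => ((count pt (A r) ω : ℕ∞) : ℝ≥0∞) ^ m) ω ∂μ ≤ ENNReal.ofReal C := by
  -- With `b - 1 = 1/512`, the growth `64 (r + 1) ^ 2 (b - 1) = (r + 1) ^ 2 / 8` loses against the
  -- void exponent `r ^ 2`, leaving a geometric series.
  obtain ⟨K, hK, hKb⟩ := exists_pow_le_mul_pow m (b := 513 / 512) (by norm_num)
  have hl : (0 : ℝ) < lam := hlam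
  have hsum : Summable fun r : ℕ => K * Real.exp (lam / 4) * Real.exp (r * -(lam / 2 : ℝ)) :=
    (Real.summable_exp_nat_mul_iff.2 (by linarith)).mul_left _
  set S := ∑' r : ℕ, K * Real.exp (lam / 4) * Real.exp (r * -(lam / 2 : ℝ)) with hS
  have hS0 : 0 ≤ S := tsum_nonneg fun r => by positivity
  refine ⟨S + 1, by linarith, fun n A B hA hB hAv hBv hBf => ?_⟩
  calc _ ≤ ∑ r ∈ Finset.range n,
        ENNReal.ofReal (K * Real.exp (lam / 4) * Real.exp (r * -(lam / 2 : ℝ))) := by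
        refine Finset.sum_le_sum fun r hr => ?_
        have hr := Finset.mem_range.1 hr
        have hAf : volume (A r ∩ slab) ≠ ∞ := ((hAv r hr).trans_lt ENNReal.ofReal_lt_top).ne
        refine (hpt.lintegral_void_mul_pow_le (hB r hr) (hBf r hr) (hA r hr) hAf hK
          (by norm_num) hKb).trans (ENNReal.ofReal_le_ofReal ?_)
        rw [mul_assoc, ← Real.exp_add]
        gcongr
        have h1 : (volume (A r ∩ slab)).toReal ≤ 64 * ((r : ℝ) + 1) ^ 2 :=
          ENNReal.toReal_le_of_le_ofReal (by positivity) (hAv r hr)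
        have h2 : (r : ℝ) ^ 2 ≤ (volume (B r ∩ slab)).toReal :=
          (ENNReal.ofReal_le_iff_le_toReal (hBf r hr)).1 (hBv r hr)
        have h3 : (r : ℝ) ≤ (r : ℝ) ^ 2 := by exact_mod_cast Nat.le_self_pow two_ne_zero r
        have h4 : (volume (A r ∩ slab)).toReal * (513 / 512 - 1) - (volume (B r ∩ slab)).toReal ≤
            1 / 4 - r / 2 := by nlinarith [sq_nonneg ((r : ℝ) - 1)]
        have := mul_le_mul_of_nonneg_left h4 hl.le
        linarith
    _ = ENNReal.ofReal (∑ r ∈ Finset.range n,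
          K * Real.exp (lam / 4) * Real.exp (r * -(lam / 2 : ℝ))) :=
        (ENNReal.ofReal_sum_of_nonneg fun r _ => by positivity).symm
    _ ≤ _ := by
        apply ENNReal.ofReal_le_ofReal
        have := hsum.sum_le_tsum (Finset.range n) fun r _ => by positivity
        linarith

end Poisson

/-! ### Exponential stabilization -/

section ExponentialStabilization

/-- The window `Q_n`, enlarged so that it contains `Q_1(x)` for all `x ∈ Q'_n`. -/
def paddedWindow : ℕ∞ → Set Space
  | ⊤ => slab
  | (n : ℕ) => box (n + 1) 0

@[simp] lemma paddedWindow_coe (n : ℕ) : paddedWindow n = box (n + 1) 0 := rfl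

lemma window_subset_paddedWindow (n : ℕ∞) : window n ⊆ paddedWindow n := by
  induction n with
  | top => exact subset_rfl
  | coe n =>
    intro y hy
    rw [window_coe, mem_box] at hy
    rw [paddedWindow_coe, mem_box]
    exact ⟨by linarith [hy.1], hy.2⟩

lemma paddedWindow_subset_slab (n : ℕ∞) : paddedWindow n ⊆ slab := by
  induction n with
  | top => exact subset_rfl
  | coe n => exact box_subset_slab _ _

lemma convex_paddedWindow (n : ℕ∞) : Convex ℝ (paddedWindow n) := by
  induction n with
  | top => exact convex_slab
  | coe n => exact convex_box _ _

lemma box_one_subset_paddedWindow {n : ℕ∞} {x : Plane}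
    (hx : ∀ k : ℕ, n = k → x ∈ square k 0) : box 1 x ⊆ paddedWindow n := by
  induction n with
  | top => exact box_subset_slab _ _
  | coe n =>
    intro y hy
    have h := mem_square.1 (hx n rfl)
    rw [mem_box, hdist_le] at hy
    rw [paddedWindow_coe, mem_box, hdist_le]
    have h0 := abs_sub_le (y 0) (x 0) 0
    have h1 := abs_sub_le (y 1) (x 1) 0
    simp only [PiLp.zero_apply, sub_zero] at *
    exact ⟨⟨by linarith [hy.1.1, h.1], by linarith [hy.1.2, h.2]⟩, hy.2⟩

/-- Truncation to `[-a, a]`. -/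
def clamp (a u : ℝ) : ℝ := max (-a) (min u a)

lemma abs_clamp_le {a : ℝ} (ha : 0 ≤ a) (u : ℝ) : |clamp a u| ≤ a := by
  unfold clamp
  exact abs_le.2 ⟨le_max_left _ _, max_le (by linarith) (min_le_right _ _)⟩

/-- A centre can be pulled back into `[-a, a]` without losing any `y` that it covers, provided `y`
is within `b` of `[-a, a]`. -/
lemma abs_sub_clamp_le {a u y b : ℝ} (ha : 0 ≤ a) (hu : |y - u| ≤ b) (hy : |y| ≤ a + b) :
    |y - clamp a u| ≤ b := by
  unfold clamp
  rw [abs_le] at *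
  rcases le_total u a with h | h
  · rw [min_eq_left h]
    rcases le_total (-a) u with h' | h'
    · rw [max_eq_right h']; constructor <;> linarith
    · rw [max_eq_left h']; constructor <;> linarith
  · rw [min_eq_right h, max_eq_right (by linarith)]; constructor <;> linarith

/-- Truncation of the coordinates to `[-a, a]`. -/
def clampPoint (a : ℝ) (u : Plane) : Plane := !₂[clamp a (u 0), clamp a (u 1)]

lemma box_clampPoint_subset {s t : ℝ} (hst : s ≤ t) (u : Plane) :
    box s (clampPoint ((t - s) / 2) u) ⊆ box t 0 := by
  intro y hy
  have ha : 0 ≤ (t - s) / 2 := by linarith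
  have h0 := abs_clamp_le ha (u 0)
  have h1 := abs_clamp_le ha (u 1)
  rw [mem_box, hdist_le] at *
  simp [clampPoint] at hy
  simp only [PiLp.zero_apply, sub_zero]
  obtain ⟨⟨h2, h3⟩, h4⟩ := hy
  rw [abs_le] at *
  exact ⟨⟨⟨by linarith, by linarith⟩, abs_le.2 ⟨by linarith, by linarith⟩⟩, h4⟩

lemma hdist_clampPoint_le {a b : ℝ} {u : Plane} {y : Space} (ha : 0 ≤ a) (hu : hdist u y ≤ b)
    (hy : hdist 0 y ≤ a + b) : hdist (clampPoint a u) y ≤ b := by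
  rw [hdist_le] at *
  simp only [PiLp.zero_apply, sub_zero] at hy
  simp only [clampPoint]
  simpa using ⟨abs_sub_clamp_le ha hu.1 hy.1, abs_sub_clamp_le ha hu.2 hy.2⟩

/-- The index is `⌊d / s⌋ + 128`, which ranges over `0, …, 256`. -/
lemma exists_fin_abs_sub_le {s d : ℝ} (hs : 0 < s) (hd : |d| ≤ 128 * s) :
    ∃ i : Fin 257, |d - s * ((i : ℕ) - 128)| ≤ s := by
  have h1 := Int.floor_le (d / s)
  have h2 := Int.lt_floor_add_one (d / s)
  rw [abs_le] at hd
  have h3 : (-128 : ℝ) ≤ d / s := by rw [le_div_iff₀ hs]; linarith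
  have h4 : d / s ≤ 128 := by rw [div_le_iff₀ hs]; linarith
  have h5 : (-128 : ℤ) ≤ ⌊d / s⌋ := Int.le_floor.2 (by exact_mod_cast h3)
  have h6 : ⌊d / s⌋ ≤ 128 := by
    have : (⌊d / s⌋ : ℝ) ≤ 128 := h1.trans h4
    exact_mod_cast this
  refine ⟨⟨(⌊d / s⌋ + 128).toNat, by omega⟩, ?_⟩
  have h7 : (((⌊d / s⌋ + 128).toNat : ℕ) : ℝ) = ⌊d / s⌋ + 128 := by
    have : (((⌊d / s⌋ + 128).toNat : ℕ) : ℤ) = ⌊d / s⌋ + 128 := Int.toNat_of_nonneg (by omega)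
    exact_mod_cast this
  simp only [h7, add_sub_cancel_right]
  rw [le_div_iff₀ hs] at h1
  rw [div_lt_iff₀ hs] at h2
  rw [abs_le]
  constructor <;> linarith

/-- The centres form a grid of mesh `s` around `x`, truncated so that the boxes stay in a finite
window. The extra `1 / 2` in the covering radius absorbs the padding. -/
lemma exists_grid {s : ℝ} (hs : 0 < s) {n : ℕ∞} (hn : ∀ k : ℕ, n = k → s ≤ k) (x : Plane) :
    ∃ c : Fin 257 × Fin 257 → Plane, (∀ i, box s (c i) ⊆ window n) ∧
      ∀ y ∈ paddedWindow n, hdist x y ≤ 128 * s → ∃ i, hdist (c i) y ≤ s + 1 / 2 := by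
  set d : Fin 257 × Fin 257 → Plane :=
    fun i => !₂[x 0 + s * ((i.1 : ℕ) - 128), x 1 + s * ((i.2 : ℕ) - 128)] with hd
  have key : ∀ y : Space, hdist x y ≤ 128 * s → ∃ i, hdist (d i) y ≤ s := by
    intro y hy
    rw [hdist_le] at hy
    obtain ⟨i, hi⟩ := exists_fin_abs_sub_le hs hy.1
    obtain ⟨j, hj⟩ := exists_fin_abs_sub_le hs hy.2
    refine ⟨(i, j), hdist_le.2 ?_⟩
    rw [sub_sub] at hi hj
    simpa [hd] using ⟨hi, hj⟩
  induction n with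
  | top =>
    refine ⟨d, fun i => box_subset_slab _ _, fun y _ hxy => ?_⟩
    obtain ⟨i, hi⟩ := key y hxy
    exact ⟨i, by linarith⟩
  | coe n =>
    refine ⟨fun i => clampPoint ((n - s) / 2) (d i), fun i => box_clampPoint_subset (hn n rfl) _,
      fun y hy hxy => ?_⟩
    obtain ⟨i, hi⟩ := key y hxy
    have := (mem_box.1 hy).1
    exact ⟨i, hdist_clampPoint_le (by linarith [hn n rfl]) (by linarith) (by linarith)⟩

/-- Each horizontal coordinate contributes at most `(s + 1/2) + s/2` to the distance and the height
at most `1`. The total `3 s + 2` is at most `4 s = (64 s) / 16`. -/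
lemma isDense_of_grid {η s : ℝ} (hs : 2 ≤ s) {n : ℕ∞} {x : Plane} {φ : Set (MarkedPoint η)}
    {ι : Type*} {c : ι → Plane}
    (hc : ∀ y ∈ paddedWindow n, hdist x y ≤ 128 * s → ∃ i, hdist (c i) y ≤ s + 1 / 2)
    (h : ∀ i, ∃ p ∈ φ, p.1 ∈ box s (c i) \ box 1 x) :
    IsDense (paddedWindow n) φ x (64 * s) := by
  intro y hy hxy
  obtain ⟨i, hi⟩ := hc y hy (by linarith)
  obtain ⟨p, hp, hpb, hp1⟩ := h i
  refine ⟨p, hp, hp1, (dist_le_sum _ _).trans ?_⟩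
  rw [mem_box, hdist_le] at hpb
  rw [hdist_le] at hi
  have h2 := mem_slab.1 (paddedWindow_subset_slab n hy)
  have h0 := abs_sub_le (y 0) (c i 0) (p.1 0)
  have h1 := abs_sub_le (y 1) (c i 1) (p.1 1)
  rw [abs_sub_comm (c i 0)] at h0
  rw [abs_sub_comm (c i 1)] at h1
  have h3 : |y 2 - p.1 2| ≤ 1 := abs_le.2 ⟨by linarith [h2.1, hpb.2.2], by linarith [h2.2, hpb.2.1]⟩
  linarith [hpb.1.1, hpb.1.2, hi.1, hi.2]

/-! ### The probability of failing to stabilize. -/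

variable {Ω : Type*} [MeasurableSpace Ω] {μ : Measure Ω} {lam : ℝ≥0} {pt : ℕ → Ω → Space}
  {η M : ℝ} {noise : ℕ → Ω → NoisePath η}

/-- A union bound; removing `Q_1(x)` costs at most volume `1` in each box. -/
lemma IsPoissonProcess.measure_void_grid_le (hpt : IsPoissonProcess μ lam pt) {s : ℝ}
    (hs : 0 ≤ s) (x : Plane) (c : Fin 257 × Fin 257 → Plane) :
    μ {ω | ∃ i, count pt (box s (c i) \ box 1 x) ω = 0} ≤
      ENNReal.ofReal (257 ^ 2 * Real.exp (-(lam * (s ^ 2 - 1)))) := by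
  have h1 : ∀ i, μ {ω | count pt (box s (c i) \ box 1 x) ω = 0} ≤
      ENNReal.ofReal (Real.exp (-(lam * (s ^ 2 - 1)))) := by
    intro i
    have hfin : volume ((box s (c i) \ box 1 x) ∩ slab) ≠ ∞ := ((measure_mono
      (Set.inter_subset_inter_left _ Set.sdiff_subset)).trans_lt
        (volume_box_inter_slab_ne_top s (c i)).lt_top).ne
    rw [hpt.measure_count_eq_zero ((measurableSet_box _ _).diff (measurableSet_box _ _)) hfin]
    gcongr
    have h2 : ENNReal.ofReal (s ^ 2 - 1) ≤ volume ((box s (c i) \ box 1 x) ∩ slab) := by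
      rw [Set.inter_eq_left.2 (Set.sdiff_subset.trans (box_subset_slab _ _)),
        ENNReal.ofReal_sub _ zero_le_one, ← volume_box hs (c i)]
      have h3 := volume_box zero_le_one x
      rw [one_pow] at h3
      rw [← h3]
      exact le_measure_sdiff
    exact (ENNReal.ofReal_le_iff_le_toReal hfin).1 h2
  have : {ω | ∃ i, count pt (box s (c i) \ box 1 x) ω = 0} =
      ⋃ i, {ω | count pt (box s (c i) \ box 1 x) ω = 0} := by ext; simp
  rw [this]
  refine (measure_iUnion_fintype_le _ _).trans ((Finset.sum_le_sum fun i _ => h1 i).trans ?_)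
  rw [Finset.sum_const, Finset.card_univ, Fintype.card_prod, Fintype.card_fin, nsmul_eq_mul,
    ENNReal.ofReal_mul (by norm_num)]
  gcongr
  norm_num

lemma IsPoissonProcess.measure_not_stabilizes_le (hpt : IsPoissonProcess μ lam pt)
    (hη : η ≤ 1 / 4) {r : ℕ} (hr : 128 ≤ r) (hM : 4 * M + 2 < r) {n : ℕ∞} {x : Plane}
    (hx : ∀ k : ℕ, n = k → x ∈ square k 0) :
    μ {ω | ¬ Stabilizes (centroidRule η) M n (within (config pt noise ω) (window n)) x r} ≤
      ENNReal.ofReal (257 ^ 2 * Real.exp (-(lam * (((r : ℝ) / 64) ^ 2 - 1)))) := by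
  have hr' : (128 : ℝ) ≤ r := by exact_mod_cast hr
  by_cases hn : ∀ k : ℕ, n = k → (r : ℝ) / 64 ≤ k
  · obtain ⟨c, hcW, hc⟩ := exists_grid (s := (r : ℝ) / 64) (by positivity) hn x
    refine (measure_mono fun ω hω => ?_).trans
      (hpt.measure_void_grid_le (s := (r : ℝ) / 64) (by positivity) x c)
    by_contra hvoid
    refine hω ?_
    have hd : IsDense (paddedWindow n) (within (config pt noise ω) (window n)) x
        (64 * ((r : ℝ) / 64)) := by
      refine isDense_of_grid (by linarith) hc fun i => ?_
      have h1 : ¬ count pt (box ((r : ℝ) / 64) (c i) \ box 1 x) ω = 0 := fun h => hvoid ⟨i, h⟩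
      rw [count_eq_zero] at h1
      push Not at h1
      obtain ⟨j, hj⟩ := h1
      exact ⟨(pt j ω, noise j ω), ⟨⟨j, rfl⟩, hcW i hj.1⟩, hj⟩
    rw [mul_div_cancel₀ _ (by norm_num)] at hd
    exact stabilizes_of_isDense hη (window_subset_paddedWindow n) (paddedWindow_subset_slab n)
      (convex_paddedWindow n) (box_one_subset_paddedWindow hx) (fun p hp => hp.2) hd
      (by linarith) hM
  · push Not at hn
    obtain ⟨k, rfl, hk⟩ := hn
    have : {ω | ¬ Stabilizes (centroidRule η) M k
        (within (config pt noise ω) (window k)) x r} = ∅ := by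
      refine Set.eq_empty_of_forall_notMem fun ω hω => hω ?_
      refine stabilizes_of_window_subset (by positivity) fun y hy => ?_
      have hxk := mem_square.1 (hx k rfl)
      rw [window_coe, mem_box, hdist_le] at hy
      rw [mem_box, hdist_le]
      simp only [PiLp.zero_apply, sub_zero] at *
      have h0 := abs_sub (y 0) (x 0)
      have h1 := abs_sub (y 1) (x 1)
      exact ⟨⟨by linarith [hy.1.1, hxk.1], by linarith [hy.1.2, hxk.2]⟩, hy.2⟩
    rw [this, measure_empty]
    exact zero_le

lemma not_stabilizes_of_lt_stabRadius' {T : Rule η} {x : Plane} {n : ℕ∞}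
    {φ : Set (MarkedPoint η)} {r : ℕ} (hr : 1 ≤ r) (h : (r : ℕ∞) < stabRadius' T M x n φ) :
    ¬ Stabilizes T M n (within φ (window n)) x r := fun hs =>
  absurd h (not_lt.2 (iInf_le_of_le r (iInf₂_le hr hs)))

theorem IsPoissonProcess.exponentiallyStabilizing (hpt : IsPoissonProcess μ lam pt)
    (hlam : 0 < lam) (hη : η ≤ 1 / 4) (M : ℝ) (noise : ℕ → Ω → NoisePath η) :
    ExponentiallyStabilizing μ (centroidRule η) M (config pt noise) := by
  -- The decay is Gaussian in `r`, so the exponent `c = 1` holds with room to spare.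
  refine ⟨1, one_pos, ?_⟩
  have hl : (0 : ℝ) < lam := hlam
  refine lt_of_le_of_lt (b := ((-1 : ℝ) : EReal)) ?_ (by norm_cast)
  refine limsup_le_of_le (by isBoundedDefault) ?_
  -- The third threshold makes `λ r ^ 2 / 4096 ≥ 2 r`. The fourth lets one of these two `r` absorb
  -- the prefactor and `λ`, leaving the bound `exp (-r)`.
  filter_upwards [eventually_ge_atTop 128, eventually_gt_atTop ⌈4 * M + 2⌉₊,
    eventually_ge_atTop ⌈8192 / (lam : ℝ)⌉₊,
    eventually_ge_atTop ⌈Real.log (2 * 257 ^ 2) + lam⌉₊] with r hr hrM hr1 hr2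
  have hr' : (128 : ℝ) ≤ r := by exact_mod_cast hr
  have hrM' : 4 * M + 2 < r := Nat.lt_of_ceil_lt hrM
  have hr1' : 8192 / (lam : ℝ) ≤ r := Nat.ceil_le.1 hr1
  have hr2' : Real.log (2 * 257 ^ 2) + lam ≤ r := Nat.ceil_le.1 hr2
  refine iSup_le fun n => iSup_le fun hn => iSup₂_le fun x hx => ?_
  have hμ : μ {ω | (r : ℕ∞) < stabRadius (centroidRule η) M x n (config pt noise ω)} ≤
      ENNReal.ofReal (Real.exp (-r)) := by
    calc _ ≤ μ ({ω | ¬ Stabilizes (centroidRule η) M n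
              (within (config pt noise ω) (window n)) x r} ∪
            {ω | ¬ Stabilizes (centroidRule η) M ⊤
              (within (config pt noise ω) (window ⊤)) x r}) := by
          refine measure_mono fun ω hω => ?_
          have hω' : (r : ℕ∞) < stabRadius' _ M x n _ ⊔ stabRadius' _ M x ⊤ _ := hω
          rcases lt_sup_iff.1 hω' with h | h
          · exact Or.inl (not_stabilizes_of_lt_stabRadius' (by omega) h)
          · exact Or.inr (not_stabilizes_of_lt_stabRadius' (by omega) h)
      _ ≤ _ := measure_union_le _ _
      _ ≤ _ := add_le_add
          (hpt.measure_not_stabilizes_le hη hr hrM' fun k hk => by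
            rw [← Nat.cast_inj (R := ℕ∞).1 hk]; exact hx)
          (hpt.measure_not_stabilizes_le hη hr hrM' fun k hk => absurd hk (by simp))
      _ = ENNReal.ofReal (2 * 257 ^ 2 * Real.exp (-(lam * (((r : ℝ) / 64) ^ 2 - 1)))) := by
          rw [← ENNReal.ofReal_add (by positivity) (by positivity)]; ring_nf
      _ ≤ _ := by
          apply ENNReal.ofReal_le_ofReal
          rw [← Real.exp_log (show (0 : ℝ) < 2 * 257 ^ 2 by norm_num), ← Real.exp_add]
          apply Real.exp_le_exp.2
          rw [div_le_iff₀ hl] at hr1'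
          have := mul_le_mul_of_nonneg_left hr1' (show (0 : ℝ) ≤ r by linarith)
          have e : (lam : ℝ) * (((r : ℝ) / 64) ^ 2 - 1) = r * (r * lam) / 4096 - lam := by ring
          rw [e]
          set L := Real.log (2 * 257 ^ 2)
          linarith
  rw [Real.rpow_one]
  have hr0 : (0 : ℝ) < r := by linarith
  have h1 : ENNReal.log (ENNReal.ofReal (Real.exp (-r))) = ((-r : ℝ) : EReal) := by
    rw [ENNReal.log_ofReal_of_pos (Real.exp_pos _), Real.log_exp]
  refine (EReal.div_le_div_right_of_nonneg (by exact_mod_cast hr0.le)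
    (ENNReal.log_monotone hμ)).trans ?_
  rw [h1, ← EReal.coe_div, neg_div, div_self hr0.ne']

end ExponentialStabilization

/-! ### Sums over independently perturbed points -/

section Perturbation

/-- The number of `i` such that `p` belongs to `E i` and `u` is within `η` of `G i p`. -/
noncomputable def hits {Θ : Type*} (η : ℝ) (E : ℕ → Set Θ) (G : ℕ → Θ → Plane) (p : Θ)
    (u : Plane) : ℕ∞ :=
  {i | p ∈ E i ∧ u - G i p ∈ Metric.closedBall (0 : Plane) η}.encard

/-- The tuples `i` such that `p ∈ E (i j)` and `x j` is within `η` of `G (i j) p` for all `j`. -/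
def hitSet {Θ : Type*} (η : ℝ) (E : ℕ → Set Θ) (G : ℕ → Θ → Plane) {q : ℕ} (p : Θ)
    (x : Fin q → Plane) : Set (Fin q ↪ ℕ) :=
  {i | ∀ j, p ∈ E (i j) ∧ x j - G (i j) p ∈ Metric.closedBall (0 : Plane) η}

lemma pi_cond_eq {ι : Type*} [Fintype ι] (K : Set Plane) (hK : MeasurableSet K) :
    Measure.pi (fun _ : ι => cond volume K) = (volume K)⁻¹ ^ Fintype.card ι •
      (volume : Measure (ι → Plane)).restrict (Set.univ.pi fun _ => K) := by
  refine Measure.pi_eq (fun s hs => ?_)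
  rw [Measure.smul_apply, Measure.restrict_apply (MeasurableSet.univ_pi hs), ← Set.pi_inter_distrib,
    volume_pi, Measure.pi_pi, smul_eq_mul, ← Finset.card_univ, ← Finset.prod_const,
    ← Finset.prod_mul_distrib]
  refine Finset.prod_congr rfl fun i _ => ?_
  rw [cond_apply hK, Set.inter_comm]

/-- Dropping the distinctness of the indices leaves a product set. -/
lemma tsum_embedding_le_prod_hits {Θ : Type*} (η : ℝ) (E : ℕ → Set Θ) (G : ℕ → Θ → Plane)
    {q : ℕ} (p : Θ) (x : Fin q → Plane) :
    ∑' i : Fin q ↪ ℕ, (hitSet η E G p x).indicator 1 i ≤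
      ∏ j, (hits η E G p (x j) : ℝ≥0∞) := by
  rw [← tsum_subtype]
  simp only [Pi.one_apply]
  rw [ENNReal.tsum_set_one]
  have h1 : (hitSet η E G p x).encard ≤ ∏ j, hits η E G p (x j) := by
    unfold hits
    rw [← Set.encard_pi_eq_prod_encard]
    exact Set.encard_le_encard_of_injOn (f := fun i : Fin q ↪ ℕ => (i : Fin q → ℕ))
      (fun i hi j _ => hi j) (fun _ _ _ _ h => DFunLike.coe_injective h)
  refine (ENat.toENNReal_le.2 h1).trans (le_of_eq ?_)
  exact map_prod ENat.toENNRealRingHom _ _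

/-! ### The density of a sum over perturbed points. -/

variable {Ω : Type*} [MeasurableSpace Ω] {μ : Measure Ω} [IsProbabilityMeasure μ]
  {Θ : Type*} [MeasurableSpace Θ] {η : ℝ} {U : Ω → Θ} {N : ℕ → Ω → Plane} {E : ℕ → Set Θ}
  {G : ℕ → Θ → Plane} {q : ℕ}

lemma measurable_indicator_hitSet (hU : Measurable U) (hE : ∀ i, MeasurableSet (E i))
    (hG : ∀ i, Measurable (G i)) (i : Fin q ↪ ℕ) :
    Measurable fun z : Ω × (Fin q → Plane) =>
      (hitSet η E G (U z.1) z.2).indicator (1 : (Fin q ↪ ℕ) → ℝ≥0∞) i := by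
  have hm : MeasurableSet {z : Ω × (Fin q → Plane) | i ∈ hitSet η E G (U z.1) z.2} := by
    have : {z : Ω × (Fin q → Plane) | i ∈ hitSet η E G (U z.1) z.2} =
        ⋂ j, ((fun z => U z.1) ⁻¹' E (i j) ∩
          (fun z : Ω × (Fin q → Plane) => z.2 j - G (i j) (U z.1)) ⁻¹' Metric.closedBall 0 η) := by
      ext z; simp [hitSet]
    rw [this]
    refine MeasurableSet.iInter fun j => ((hU.comp measurable_fst) (hE _)).inter ?_
    exact (((measurable_pi_apply j).comp measurable_snd).sub
      ((hG _).comp (hU.comp measurable_fst))) Metric.isClosed_closedBall.measurableSet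
  exact measurable_one.indicator hm

/-- Given `U`, the noise vector is uniform on a product of balls, as the indices are distinct. A
translation by the centres turns the integral over the noise into one over the perturbed positions,
and Tonelli moves the expectation inside. -/
lemma lintegral_perturbed_eq (hU : Measurable U) (hN : ∀ i, Measurable (N i))
    (hUN : IndepFun (fun ω i => N i ω) U μ) (hNN : iIndepFun N μ)
    (hlaw : ∀ i, μ.map (N i) = cond volume (Metric.closedBall (0 : Plane) η))
    (hE : ∀ i, MeasurableSet (E i)) (hG : ∀ i, Measurable (G i)) (i : Fin q ↪ ℕ)
    {f : (Fin q → Plane) → ℝ≥0∞} (hf : Measurable f) :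
    ∫⁻ ω, {ω | ∀ j, U ω ∈ E (i j)}.indicator
        (fun ω => f fun j => G (i j) (U ω) + N (i j) ω) ω ∂μ =
      (volume (Metric.closedBall (0 : Plane) η))⁻¹ ^ q * ∫⁻ x, f x * ∫⁻ ω,
        (hitSet η E G (U ω) x).indicator 1 i ∂μ := by
  set D : Set (Fin q → Plane) := Set.univ.pi fun _ => Metric.closedBall (0 : Plane) η with hD
  have hDm : MeasurableSet D :=
    MeasurableSet.univ_pi fun _ => Metric.isClosed_closedBall.measurableSet
  set V : Ω → Fin q → Plane := fun ω j => N (i j) ω with hV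
  have hVm : Measurable V := measurable_pi_lambda _ fun j => hN (i j)
  have hUV : IndepFun U V μ :=
    (hUN.comp (φ := fun w : ℕ → Plane => fun j => w (i j))
      (measurable_pi_lambda _ fun j => measurable_pi_apply (i j)) measurable_id).symm
  have hVlaw : μ.map V = (volume (Metric.closedBall (0 : Plane) η))⁻¹ ^ q • volume.restrict D := by
    rw [(iIndepFun_iff_map_fun_eq_pi_map fun j => (hN (i j)).aemeasurable).1
      (hNN.precomp i.injective)]
    simp_rw [hlaw]
    rw [pi_cond_eq _ Metric.isClosed_closedBall.measurableSet, Fintype.card_fin]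
  set E' : Set Θ := ⋂ j, E (i j) with hE'
  have hE'm : MeasurableSet E' := MeasurableSet.iInter fun j => hE (i j)
  set G' : Θ → Fin q → Plane := fun p j => G (i j) p with hG'
  have hG'm : Measurable G' := measurable_pi_lambda _ fun j => hG (i j)
  have hF : Measurable fun z : Θ × (Fin q → Plane) =>
      E'.indicator (1 : Θ → ℝ≥0∞) z.1 * f (G' z.1 + z.2) :=
    ((measurable_one.indicator hE'm).comp measurable_fst).mul
      (hf.comp ((hG'm.comp measurable_fst).add measurable_snd))
  have hprod : μ.map (fun ω => (U ω, V ω)) = (μ.map U).prod (μ.map V) :=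
    (indepFun_iff_map_prod_eq_prod_map_map hU.aemeasurable hVm.aemeasurable).1 hUV
  have hhit : Measurable fun z : Ω × (Fin q → Plane) =>
      (hitSet η E G (U z.1) z.2).indicator (1 : (Fin q ↪ ℕ) → ℝ≥0∞) i :=
    measurable_indicator_hitSet hU hE hG i
  have hinner : ∀ ω, ∫⁻ v, E'.indicator (1 : Θ → ℝ≥0∞) (U ω) * f (G' (U ω) + v) ∂μ.map V =
      (volume (Metric.closedBall (0 : Plane) η))⁻¹ ^ q *
        ∫⁻ x, f x * (hitSet η E G (U ω) x).indicator 1 i := by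
    intro ω
    -- Substitution `v = x - G' (U ω)`; the constraint `v ∈ D` becomes the hit condition on `x`.
    rw [hVlaw, lintegral_smul_measure, smul_eq_mul, ← lintegral_indicator hDm,
      ← lintegral_sub_right_eq_self _ (G' (U ω))]
    congr 2
    ext1 x
    have hiff : i ∈ hitSet η E G (U ω) x ↔ U ω ∈ E' ∧ x - G' (U ω) ∈ D := by
      simp only [hitSet, Set.mem_ofPred_eq, hE', hD, Set.mem_iInter, Set.mem_univ_pi, hG',
        Pi.sub_apply, forall_and]
    by_cases h1 : U ω ∈ E' <;> by_cases h2 : x - G' (U ω) ∈ D <;>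
      simp [Set.indicator, hiff, h1, h2]
  calc _ = ∫⁻ ω, E'.indicator (1 : Θ → ℝ≥0∞) (U ω) * f (G' (U ω) + V ω) ∂μ := by
        refine lintegral_congr fun ω => ?_
        have hiff : (ω ∈ {ω | ∀ j, U ω ∈ E (i j)}) ↔ U ω ∈ E' := by simp [hE']
        by_cases h1 : U ω ∈ E'
        · rw [Set.indicator_of_mem (hiff.2 h1), Set.indicator_of_mem h1, Pi.one_apply, one_mul]
          rfl
        · rw [Set.indicator_of_notMem (mt hiff.1 h1), Set.indicator_of_notMem h1, zero_mul]
    _ = ∫⁻ ω, ∫⁻ v, E'.indicator (1 : Θ → ℝ≥0∞) (U ω) * f (G' (U ω) + v) ∂μ.map V ∂μ := by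
        have h1 := lintegral_map (μ := μ) hF (hU.prodMk hVm)
        have : IsProbabilityMeasure (μ.map V) := Measure.isProbabilityMeasure_map hVm.aemeasurable
        rw [hprod, lintegral_prod _ hF.aemeasurable,
          lintegral_map hF.lintegral_prod_right' hU] at h1
        exact h1.symm
    _ = (volume (Metric.closedBall (0 : Plane) η))⁻¹ ^ q *
        ∫⁻ ω, (∫⁻ x, f x * (hitSet η E G (U ω) x).indicator 1 i) ∂μ := by
        simp_rw [hinner]
        refine lintegral_const_mul _ ?_
        exact Measurable.lintegral_prod_right' ((hf.comp measurable_snd).mul hhit)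
    _ = _ := by
        congr 1
        rw [lintegral_lintegral_swap ((hf.comp measurable_snd).mul hhit).aemeasurable]
        refine lintegral_congr fun x => ?_
        exact lintegral_const_mul _ (hhit.comp measurable_prodMk_right)

instance countable_embedding_nat : Countable (Fin q ↪ ℕ) := DFunLike.coe_injective.countable

/-- Summation of independently and uniformly perturbed points yields a density, which is bounded if
the numbers of unperturbed points in balls have bounded moments. -/
theorem exists_density_of_perturbed (hU : Measurable U) (hN : ∀ i, Measurable (N i))
    (hUN : IndepFun (fun ω i => N i ω) U μ) (hNN : iIndepFun N μ)
    (hlaw : ∀ i, μ.map (N i) = cond volume (Metric.closedBall (0 : Plane) η))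
    (hE : ∀ i, MeasurableSet (E i)) (hG : ∀ i, Measurable (G i)) {C : ℝ≥0∞}
    (hC : ∀ x : Fin q → Plane, ∫⁻ ω, ∏ j, (hits η E G (U ω) (x j) : ℝ≥0∞) ∂μ ≤ C) :
    ∃ ρ : (Fin q → Plane) → ℝ≥0∞, Measurable ρ ∧
      (∀ x, ρ x ≤ (volume (Metric.closedBall (0 : Plane) η))⁻¹ ^ q * C) ∧
      ∀ f : (Fin q → Plane) → ℝ≥0∞, Measurable f →
        ∫⁻ ω, ∑' i : Fin q ↪ ℕ, {ω | ∀ j, U ω ∈ E (i j)}.indicator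
          (fun ω => f fun j => G (i j) (U ω) + N (i j) ω) ω ∂μ = ∫⁻ x, f x * ρ x := by
  have hhit : ∀ i : Fin q ↪ ℕ, Measurable fun z : Ω × (Fin q → Plane) =>
      (hitSet η E G (U z.1) z.2).indicator (1 : (Fin q ↪ ℕ) → ℝ≥0∞) i :=
    fun i => measurable_indicator_hitSet hU hE hG i
  have hint : ∀ i : Fin q ↪ ℕ, Measurable fun x : Fin q → Plane =>
      ∫⁻ ω, (hitSet η E G (U ω) x).indicator (1 : (Fin q ↪ ℕ) → ℝ≥0∞) i ∂μ :=
    fun i => (hhit i).lintegral_prod_left'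
  refine ⟨fun x => (volume (Metric.closedBall (0 : Plane) η))⁻¹ ^ q *
    ∑' i : Fin q ↪ ℕ, ∫⁻ ω, (hitSet η E G (U ω) x).indicator 1 i ∂μ,
    (Measurable.tsum hint).const_mul _, fun x => ?_, fun f hf => ?_⟩
  · dsimp only
    gcongr
    have hx : ∀ i : Fin q ↪ ℕ, Measurable fun ω =>
        (hitSet η E G (U ω) x).indicator (1 : (Fin q ↪ ℕ) → ℝ≥0∞) i :=
      fun i => (hhit i).comp measurable_prodMk_right
    rw [← lintegral_tsum fun i => (hx i).aemeasurable]
    exact (lintegral_mono fun ω => tsum_embedding_le_prod_hits η E G (U ω) x).trans (hC x)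
  · rw [lintegral_tsum]
    · simp_rw [lintegral_perturbed_eq hU hN hUN hNN hlaw hE hG _ hf]
      have hmul : ∀ i : Fin q ↪ ℕ, Measurable fun x : Fin q → Plane =>
          f x * ∫⁻ ω, (hitSet η E G (U ω) x).indicator (1 : (Fin q ↪ ℕ) → ℝ≥0∞) i ∂μ :=
        fun i => hf.mul (hint i)
      have hmul' : Measurable fun x : Fin q → Plane => f x *
          ∑' i : Fin q ↪ ℕ, ∫⁻ ω,
            (hitSet η E G (U ω) x).indicator (1 : (Fin q ↪ ℕ) → ℝ≥0∞) i ∂μ :=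
        hf.mul (Measurable.tsum hint)
      rw [ENNReal.tsum_mul_left, ← lintegral_tsum fun i => (hmul i).aemeasurable]
      simp_rw [ENNReal.tsum_mul_left]
      rw [← lintegral_const_mul _ hmul']
      refine lintegral_congr fun x => ?_
      ring
    · intro i
      refine (Measurable.indicator ?_ ?_).aemeasurable
      · exact hf.comp (measurable_pi_lambda _ fun j => ((hG (i j)).comp hU).add (hN (i j)))
      · rw [Set.ofPred_forall]
        exact MeasurableSet.iInter fun j => hU (hE (i j))

end Perturbation

/-! ### Factorial moment densities of the trajectories -/

section FactorialMoments

variable {η h : ℝ} {W S : Set Space} {n : ℕ}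

/-- The section at height `h` of the cell of `p i` in the Voronoi tessellation of `W` generated by
those points `p j` that lie in `W`. -/
def sectionCell (W : Set Space) (h : ℝ) (i : ℕ) (p : ℕ → Space) : Set Plane :=
  {u | lift u h ∈ W ∧ ∀ j, p j ∈ W → dist (lift u h) (p i) ≤ dist (lift u h) (p j)}

/-- The event that `p i ∈ S` and that the trajectory of `p i` is present at height `h`. -/
def presentSet (W S : Set Space) (h : ℝ) (i : ℕ) : Set (ℕ → Space) :=
  {p | p i ∈ S ∧ 0 < volume (sectionCell W h i p)}

lemma measurableSet_sectionCell (hW : MeasurableSet W) (h : ℝ) (i : ℕ) :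
    MeasurableSet {z : (ℕ → Space) × Plane | z.2 ∈ sectionCell W h i z.1} := by
  have hp : ∀ j, Measurable fun p : ℕ → Space => p j := fun j => measurable_pi_apply j
  have h1 : MeasurableSet {z : (ℕ → Space) × Space | z.2 ∈ W ∧
      ∀ j, z.1 ∈ {p : ℕ → Space | p j ∈ W} → dist z.2 (z.1 i) ≤ dist z.2 (z.1 j)} :=
    measurableSet_parametrized_cell hW (hp i) hp fun j => hp j hW
  exact measurableSet_parametrized_slice h1 h

lemma measurableSet_presentSet (hW : MeasurableSet W) (hS : MeasurableSet S) (h : ℝ) (i : ℕ) :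
    MeasurableSet (presentSet W S h i) :=
  ((measurable_pi_apply i) hS).inter (measurableSet_lt (measurable_const (a := (0 : ℝ≥0∞)))
    (measurable_measure_prodMk_left (measurableSet_sectionCell hW h i)))

lemma measurable_centroid_sectionCell (hW : MeasurableSet W) (h : ℝ) (i : ℕ) :
    Measurable fun p => centroid (sectionCell W h i p) := by
  have h1 := measurable_centroid (measurableSet_sectionCell hW h i)
  exact h1

lemma slice_cell_config {Ω : Type*} (pt : ℕ → Ω → Space) (noise : ℕ → Ω → NoisePath η) (ω : Ω)
    (i : ℕ) : slice (cell W (pt i ω, noise i ω) (within (config pt noise ω) W)) h =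
      sectionCell W h i fun j => pt j ω := by
  ext u
  constructor
  · rintro ⟨h1, h2⟩
    exact ⟨h1, fun j hj => h2 (pt j ω, noise j ω) ⟨⟨j, rfl⟩, hj⟩⟩
  · rintro ⟨h1, h2⟩
    refine ⟨h1, ?_⟩
    rintro _ ⟨⟨j, rfl⟩, hj⟩
    exact h2 j hj

lemma isBounded_cell_window {P : MarkedPoint η} {φ : Set (MarkedPoint η)} :
    Bornology.IsBounded (cell (window n) P φ) :=
  (isBounded_box n 0).subset fun _ hy => hy.1

lemma mem_slice_trajectories {Ω : Type*} {pt : ℕ → Ω → Space} {noise : ℕ → Ω → NoisePath η}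
    {s : ℕ → ℝ} (hh : h ∈ unitInterval) {ω : Ω} {i : ℕ} {u : Plane} :
    u ∈ slice (trajectories (centroidRule η) pt noise s n ω i) h ↔
      (fun j => pt j ω) ∈ presentSet (window n) (box (s n) 0) h i ∧
      u = centroid (sectionCell (window n) h i fun j => pt j ω) +
        (noise i ω ⟨h, hh⟩ : Plane) := by
  have : u ∈ slice (trajectories (centroidRule η) pt noise s n ω i) h ↔ pt i ω ∈ box (s n) 0 ∧
      u ∈ slice (centroidRule η (window n) (pt i ω, noise i ω)
        (within (config pt noise ω) (window n))) h := Iff.rfl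
  rw [this, mem_slice_centroidRule, slice_cell_config]
  constructor
  · rintro ⟨h1, -, _, h2, h3⟩
    exact ⟨⟨h1, h2⟩, h3⟩
  · rintro ⟨⟨h1, h2⟩, h3⟩
    exact ⟨h1, isBounded_cell_window, hh, h2, h3⟩

/-- Attaching zero noise makes `sectionCell` a section of a `cell`, whose convexity and closedness
are known. -/
lemma centroid_sectionCell_mem {i : ℕ} {p : ℕ → Space}
    (hp : 0 < volume (sectionCell (window n) h i p)) :
    centroid (sectionCell (window n) h i p) ∈ sectionCell (window n) h i p := by
  have e := slice_cell_config (η := 1) (h := h) (W := window n)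
    (fun j (p : ℕ → Space) => p j) (fun _ _ _ => ⟨0, by simp⟩) p i
  rw [← e] at hp ⊢
  exact centroid_mem (isBounded_slice isBounded_cell_window h)
    (convex_slice (convex_cell (convex_window n)) h)
    (isClosed_slice (isClosed_cell (isClosed_window n)) h) hp

/-- Trajectories have at most one position per height, so the sum over tuples of positions has at
most one term. The indicator over `Unit` encodes the condition `E`. -/
lemma tsum_unique_tuple {q : ℕ} {X : Fin q → Set Plane} {E : Prop} {a : Fin q → Plane}
    (hX : ∀ u : Fin q → Plane, (∀ j, u j ∈ X j) ↔ E ∧ u = a) (f : (Fin q → Plane) → ℝ≥0∞) :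
    ∑' u : {u : Fin q → Plane // ∀ j, u j ∈ X j}, f u.1 =
      {_b : Unit | E}.indicator (fun _ => f a) () := by
  by_cases hE : E
  · have : {u : Fin q → Plane | ∀ j, u j ∈ X j} = {a} := by
      ext u; exact (hX u).trans (and_iff_right hE)
    rw [Set.indicator_of_mem (show () ∈ {_b : Unit | E} from hE)]
    exact (tsum_congr_set_coe f this).trans (tsum_singleton a f)
  · have : {u : Fin q → Plane | ∀ j, u j ∈ X j} = ∅ :=
      Set.eq_empty_of_forall_notMem fun u hu => hE ((hX u).1 hu).1
    rw [Set.indicator_of_notMem (show () ∉ {_b : Unit | E} from hE)]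
    exact (tsum_congr_set_coe f this).trans tsum_empty

lemma prod_le_sum_pow {q : ℕ} (a : Fin (q + 1) → ℝ≥0∞) : ∏ j, a j ≤ ∑ j, a j ^ (q + 1) := by
  obtain ⟨k, -, hk⟩ := Finset.exists_max_image Finset.univ a ⟨0, Finset.mem_univ _⟩
  calc ∏ j, a j ≤ ∏ _j : Fin (q + 1), a k := Finset.prod_le_prod' fun j hj => hk j hj
    _ = a k ^ (q + 1) := by simp
    _ ≤ _ := Finset.single_le_sum (f := fun j => a j ^ (q + 1)) (fun _ _ => zero_le)
      (Finset.mem_univ k)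

/-- Points of the plane-column above the square of side `2 t` around `u`. -/
def column (t : ℝ) (u : Plane) : Set Space := {y | hdist u y ≤ t}

lemma measurableSet_column (t : ℝ) (u : Plane) : MeasurableSet (column t u) :=
  measurableSet_le (continuous_hdist u).measurable measurable_const

lemma volume_column_inter_slab {t : ℝ} (ht : 0 ≤ t) (u : Plane) :
    volume (column t u ∩ slab) = ENNReal.ofReal ((2 * t) ^ 2) := by
  have : column t u ∩ slab = box (2 * t) u := by
    ext y
    rw [mem_box, mul_div_cancel_left₀ t two_ne_zero, Set.mem_inter_iff, mem_slab]
    rfl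
  rw [this, volume_box (by positivity)]

/-- Boxes of side `r` in the window `Q_n` that are close to `u`; for `r = 0` the empty set. -/
def nearBox (n : ℕ) (u : Plane) (r : ℕ) : Set Space :=
  if r = 0 then ∅ else box r (clampPoint (((n : ℝ) - r) / 2) u)

lemma measurableSet_nearBox (n : ℕ) (u : Plane) (r : ℕ) : MeasurableSet (nearBox n u r) := by
  unfold nearBox
  split_ifs
  · exact MeasurableSet.empty
  · exact measurableSet_box _ _

lemma volume_nearBox_inter_slab (n : ℕ) (u : Plane) (r : ℕ) :
    volume (nearBox n u r ∩ slab) = ENNReal.ofReal ((r : ℝ) ^ 2) := by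
  unfold nearBox
  split_ifs with hr
  · simp [hr]
  · rw [Set.inter_eq_left.2 (box_subset_slab _ _), volume_box (by positivity)]

lemma nearBox_self (hn : n ≠ 0) (u : Plane) : nearBox n u n = window n := by
  rw [nearBox, if_neg hn, window_coe]
  congr 1
  apply plane_ext <;> simp [clampPoint, clamp]

/-- If `Q_n` contains points of `p` near `u`, then the points whose trajectories pass near `u` are
themselves near `u`. -/
lemma mem_column_of_hit (hη : η ≤ 1 / 4) {u : Plane} {r : ℕ} (hr : 1 ≤ r) (hrn : r ≤ n)
    {p : ℕ → Space} {k : ℕ} (hk : p k ∈ nearBox n u r) {i : ℕ}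
    (hi : 0 < volume (sectionCell (window n) h i p))
    (hd : u - centroid (sectionCell (window n) h i p) ∈ Metric.closedBall (0 : Plane) η) :
    p i ∈ column (4 * r) u := by
  have hr' : (1 : ℝ) ≤ r := by exact_mod_cast hr
  have hrn' : (r : ℝ) ≤ n := by exact_mod_cast hrn
  rw [nearBox, if_neg (by omega)] at hk
  obtain ⟨h1, h2⟩ := centroid_sectionCell_mem hi
  set g := centroid (sectionCell (window n) h i p)
  have h3 := h2 k (box_clampPoint_subset hrn' u hk)
  have hug : hdist u (lift g h) ≤ 1 / 4 := by
    have h4 := hdist_le_add_dist u (lift g h) (lift u h)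
    have h5 : hdist u (lift u h) = 0 := by simp [hdist]
    rw [dist_lift, h5, dist_comm, dist_eq_norm] at h4
    rw [mem_closedBall_zero_iff] at hd
    linarith
  have h1' := mem_box.1 h1
  have hc := hdist_clampPoint_le (a := ((n : ℝ) - r) / 2) (b := (r : ℝ) / 2) (by linarith)
    (hug.trans (by linarith)) (by linarith [h1'.1])
  have hk' := mem_box.1 hk
  -- The centre of the box is horizontally within `r / 2` of both `g` and `p k` in each coordinate,
  -- and heights differ by at most `1`. The generator `p i` is at least as close to `g` as `p k` is,
  -- and `2 r + 1 + 1/4 ≤ 4 r`.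
  have hdist1 : dist (lift g h) (p k) ≤ 2 * r + 1 := by
    refine (dist_le_sum _ _).trans ?_
    rw [hdist_le] at hc
    have hk1 := hdist_le.1 hk'.1
    have e0 := abs_sub_le (lift g h 0) (clampPoint (((n : ℝ) - r) / 2) u 0) (p k 0)
    have e1 := abs_sub_le (lift g h 1) (clampPoint (((n : ℝ) - r) / 2) u 1) (p k 1)
    have e2 : |lift g h 2 - p k 2| ≤ 1 :=
      abs_le.2 ⟨by linarith [h1'.2.1, hk'.2.2], by linarith [h1'.2.2, hk'.2.1]⟩
    rw [abs_sub_comm (clampPoint _ _ 0)] at e0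
    rw [abs_sub_comm (clampPoint _ _ 1)] at e1
    linarith [hc.1, hc.2, hk1.1, hk1.2]
  have := hdist_le_add_dist u (p i) (lift g h)
  rw [dist_comm] at this
  show hdist u (p i) ≤ 4 * r
  linarith

/-! ### Moments of the number of centroids near a location. -/

variable {Ω : Type*} {pt : ℕ → Ω → Space}

/-- A single term of the sum suffices: the index is one less than the first size at which the near
box contains a point. Such a size exists and is at most `n`, because a hit puts a point in `Q_n`,
the near box of size `n`. -/
lemma hits_pow_le (hη : η ≤ 1 / 4) (hS : S ⊆ window n) (hn : n ≠ 0) {m : ℕ} (hm : m ≠ 0)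
    (u : Plane) (ω : Ω) :
    (hits η (presentSet (window n) S h) (fun i p => centroid (sectionCell (window n) h i p))
        (fun j => pt j ω) u : ℝ≥0∞) ^ m ≤
      ∑ r ∈ Finset.range n, {ω | count pt (nearBox n u r) ω = 0}.indicator
        (fun ω => ((count pt (column (4 * ((r : ℝ) + 1)) u) ω : ℕ∞) : ℝ≥0∞) ^ m) ω := by
  classical
  by_cases h0 : hits η (presentSet (window n) S h)
      (fun i p => centroid (sectionCell (window n) h i p)) (fun j => pt j ω) u = 0
  · rw [h0]; simp [hm]
  have hex : ∃ r, count pt (nearBox n u r) ω ≠ 0 := by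
    obtain ⟨i, hi, -⟩ := Set.nonempty_iff_ne_empty.2 (mt Set.encard_eq_zero.2 h0)
    refine ⟨n, fun hc => ?_⟩
    rw [nearBox_self hn, count_eq_zero] at hc
    exact hc i (hS hi.1)
  obtain ⟨i₀, hi₀, -⟩ := Set.nonempty_iff_ne_empty.2 (mt Set.encard_eq_zero.2 h0)
  have hle : Nat.find hex ≤ n := Nat.find_min' hex fun hc => by
    rw [nearBox_self hn, count_eq_zero] at hc
    exact hc i₀ (hS hi₀.1)
  -- The near box of size `0` is empty by definition, so the first occupied size has a predecessor,
  -- whose box is void.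
  have hpos : Nat.find hex ≠ 0 := fun h => by
    have := Nat.find_spec hex
    rw [h] at this
    exact this (count_eq_zero.2 fun i => by simp [nearBox])
  obtain ⟨r, hr⟩ := Nat.exists_eq_succ_of_ne_zero hpos
  have hvoid : count pt (nearBox n u r) ω = 0 := by
    by_contra hc
    have := Nat.find_min' hex hc
    omega
  refine le_trans ?_ (Finset.single_le_sum (fun _ _ => zero_le)
    (Finset.mem_range.2 (show r < n by omega)))
  rw [Set.indicator_of_mem (show ω ∈ {ω | count pt (nearBox n u r) ω = 0} from hvoid)]
  gcongr
  have hspec := Nat.find_spec hex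
  rw [hr, Ne, count_eq_zero] at hspec
  push Not at hspec
  obtain ⟨k, hk⟩ := hspec
  refine Set.encard_le_encard fun i hi => ?_
  have := mem_column_of_hit hη (p := fun j => pt j ω) (Nat.succ_le_succ (Nat.zero_le r))
    (by omega) hk hi.1.2 hi.2
  rwa [Nat.cast_succ] at this

variable [MeasurableSpace Ω] {μ : Measure Ω} {lam : ℝ≥0}

lemma IsPoissonProcess.exists_lintegral_prod_hits_le (hpt : IsPoissonProcess μ lam pt)
    (hlam : 0 < lam) (hη : η ≤ 1 / 4) (q : ℕ) : ∃ C : ℝ, 0 < C ∧ ∀ (n : ℕ) (S : Set Space) (h : ℝ),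
      n ≠ 0 → S ⊆ window n → ∀ x : Fin (q + 1) → Plane,
        ∫⁻ ω, ∏ j, (hits η (presentSet (window n) S h)
          (fun i p => centroid (sectionCell (window n) h i p)) (fun j => pt j ω) (x j) : ℝ≥0∞) ∂μ ≤
        ENNReal.ofReal C := by
  obtain ⟨C, hC0, hC⟩ := hpt.exists_sum_lintegral_void_mul_pow_le hlam (q + 1)
  refine ⟨(q + 1 : ℕ) * C, by positivity, fun n S h hn hS x => ?_⟩
  have hae : ∀ (u : Plane) (r : ℕ), AEMeasurable (fun ω =>
      {ω | count pt (nearBox n u r) ω = 0}.indicator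
        (fun ω => ((count pt (column (4 * ((r : ℝ) + 1)) u) ω : ℕ∞) : ℝ≥0∞) ^ (q + 1)) ω) μ := by
    intro u r
    have h1 := hpt.aemeasurable_count (measurableSet_nearBox n u r)
      (by rw [volume_nearBox_inter_slab]; exact ENNReal.ofReal_ne_top)
    have h2 := hpt.aemeasurable_count (measurableSet_column (4 * ((r : ℝ) + 1)) u)
      (by rw [volume_column_inter_slab (by positivity)]; exact ENNReal.ofReal_ne_top)
    have h3 : NullMeasurableSet {ω | count pt (nearBox n u r) ω = 0} μ :=
      h1.nullMeasurable (measurableSet_singleton 0)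
    exact ((Measurable.of_discrete (f := fun k : ℕ∞ => (k : ℝ≥0∞) ^ (q + 1))).comp_aemeasurable
      h2).indicator₀ h3
  calc _ ≤ ∫⁻ ω, ∑ j, ∑ r ∈ Finset.range n, {ω | count pt (nearBox n (x j) r) ω = 0}.indicator
        (fun ω => ((count pt (column (4 * ((r : ℝ) + 1)) (x j)) ω : ℕ∞) : ℝ≥0∞) ^ (q + 1)) ω ∂μ :=
        lintegral_mono fun ω => (prod_le_sum_pow _).trans
          (Finset.sum_le_sum fun j _ => hits_pow_le hη hS hn (Nat.succ_ne_zero q) (x j) ω)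
    _ = ∑ j, ∑ r ∈ Finset.range n, ∫⁻ ω, {ω | count pt (nearBox n (x j) r) ω = 0}.indicator
        (fun ω => ((count pt (column (4 * ((r : ℝ) + 1)) (x j)) ω : ℕ∞) : ℝ≥0∞) ^ (q + 1)) ω ∂μ := by
        rw [lintegral_finsetSum' _ fun j _ => Finset.aemeasurable_fun_sum _ fun r _ => hae (x j) r]
        exact Finset.sum_congr rfl fun j _ => lintegral_finsetSum' _ fun r _ => hae (x j) r
    _ ≤ ∑ _j : Fin (q + 1), ENNReal.ofReal C := by
        refine Finset.sum_le_sum fun j _ => hC n _ _ (fun r _ => measurableSet_column _ _)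
          (fun r _ => measurableSet_nearBox _ _ _) (fun r _ => ?_) (fun r _ => ?_) (fun r _ => ?_)
        -- Half-width `4 (r + 1)` means side `8 (r + 1)`, whence the constant `64`.
        · rw [volume_column_inter_slab (by positivity)]
          apply ENNReal.ofReal_le_ofReal
          linarith
        · rw [volume_nearBox_inter_slab]
        · rw [volume_nearBox_inter_slab]; exact ENNReal.ofReal_ne_top
    _ = _ := by
        rw [Finset.sum_const, Finset.card_univ, Fintype.card_fin, nsmul_eq_mul,
          ENNReal.ofReal_mul (by positivity), ENNReal.ofReal_natCast]

theorem IsPoissonProcess.factorialMomentBound [IsProbabilityMeasure μ]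
    (hpt : IsPoissonProcess μ lam pt) (hlam : 0 < lam) (hη : 0 < η) (hη' : η ≤ 1 / 4)
    {noise : ℕ → Ω → NoisePath η} (hnoise : IsUniformNoise μ pt noise) {s : ℕ → ℝ}
    (hs : ∀ n, s n ≤ n) :
    FactorialMomentBound μ (trajectories (centroidRule η) pt noise s) := by
  intro q
  obtain ⟨C, hC0, hC⟩ := hpt.exists_lintegral_prod_hits_le hlam hη' q
  set κ := (volume (Metric.closedBall (0 : Plane) η))⁻¹ ^ (q + 1) * ENNReal.ofReal C with hκ
  have hκt : κ ≠ ∞ := ENNReal.mul_ne_top (ENNReal.pow_ne_top (ENNReal.inv_ne_top.2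
    (Metric.measure_closedBall_pos volume _ hη).ne')) ENNReal.ofReal_ne_top
  -- `κ` involves neither `n` nor `h`; adding `1` secures positivity.
  refine ⟨κ.toReal + 1, by positivity, fun n hn h hh => ?_⟩
  have hWm : MeasurableSet (window n) := (isClosed_window n).measurableSet
  have hev : Measurable fun N : NoisePath η => (N ⟨h, hh⟩ : Plane) :=
    measurable_subtype_coe.comp (measurable_pi_apply _)
  have hS : box (s n) 0 ⊆ window n := fun y hy => by
    have := mem_box.1 hy
    exact mem_box.2 ⟨by linarith [this.1, hs n], this.2⟩
  -- Only the noise at the single height `h` enters, so the dependence between heights is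
  -- irrelevant.
  obtain ⟨ρ, hρm, hρC, hρ⟩ := exists_density_of_perturbed (μ := μ) (η := η) (q := q + 1)
    (U := fun ω j => pt j ω) (N := fun i ω => (noise i ω ⟨h, hh⟩ : Plane))
    (E := presentSet (window n) (box (s n) 0) h)
    (G := fun i p => centroid (sectionCell (window n) h i p))
    (measurable_pi_lambda _ hpt.measurable_pt) (fun i => hev.comp (hnoise.measurable_noise i))
    (hnoise.indep_pt.comp (φ := fun (N : ℕ → NoisePath η) i => (N i ⟨h, hh⟩ : Plane))
      (measurable_pi_lambda _ fun i => hev.comp (measurable_pi_apply i)) measurable_id)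
    (hnoise.iIndep.comp _ fun _ => hev) (fun i => hnoise.uniform i ⟨h, hh⟩)
    (fun i => measurableSet_presentSet hWm (measurableSet_box _ _) h i)
    (fun i => measurable_centroid_sectionCell hWm h i)
    (hC n (box (s n) 0) h (by omega) hS)
  refine ⟨ρ, hρm, fun x => (hρC x).trans ?_, fun f hf => ?_⟩
  · rw [← hκ]
    calc κ = ENNReal.ofReal κ.toReal := (ENNReal.ofReal_toReal hκt).symm
      _ ≤ _ := ENNReal.ofReal_le_ofReal (by linarith)
  · rw [← hρ f hf]
    refine lintegral_congr fun ω => tsum_congr fun i => ?_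
    refine (tsum_unique_tuple (fun u => ?_) f).trans rfl
    simp only [mem_slice_trajectories hh, forall_and, funext_iff]

end FactorialMoments

end SlicedVoronoi

theorem mainTheorem3 {Ω : Type*} [MeasurableSpace Ω] (μ : Measure Ω) [IsProbabilityMeasure μ]
    (lam : ℝ≥0) (hlam : 0 < lam) (η₀ : ℝ) (hη₀ : 0 < η₀) (hη₀' : η₀ < 1 / 4)
    (M : ℝ) (hM : 0 < M)
    (pt : ℕ → Ω → SlicedVoronoi.Space) (hpt : SlicedVoronoi.IsPoissonProcess μ lam pt)
    (noise : ℕ → Ω → SlicedVoronoi.NoisePath η₀)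
    (hnoise : SlicedVoronoi.IsUniformNoise μ pt noise) :
    SlicedVoronoi.MeasurableRule (SlicedVoronoi.centroidRule η₀) ∧
    SlicedVoronoi.TranslationCovariant (SlicedVoronoi.centroidRule η₀) ∧
    SlicedVoronoi.ExponentiallyStabilizing μ (SlicedVoronoi.centroidRule η₀) M
      (SlicedVoronoi.config pt noise) ∧
    SlicedVoronoi.FactorialMomentBound μ
      (SlicedVoronoi.trajectories (SlicedVoronoi.centroidRule η₀) pt noise
        (fun n => (n : ℝ) - √(n : ℝ))) ∧
    SlicedVoronoi.FactorialMomentBound μ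
      (SlicedVoronoi.trajectories (SlicedVoronoi.centroidRule η₀) pt noise
        (fun n => (n : ℝ))) := by
  refine ⟨SlicedVoronoi.measurableRule_centroidRule η₀,
    SlicedVoronoi.translationCovariant_centroidRule η₀,
    hpt.exponentiallyStabilizing hlam hη₀'.le M noise,
    hpt.factorialMomentBound hlam hη₀ hη₀'.le hnoise fun n => ?_,
    hpt.factorialMomentBound hlam hη₀ hη₀'.le hnoise fun n => le_rfl⟩
  linarith [Real.sqrt_nonneg (n : ℝ)]
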